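/- Let $K_n$ be the complete graph on $n$ vertices and let $A_n\subseteq\mathbb{R}^{n\times n}$ be the (finite) set of adjacency matrices of the Hamiltonian cycles of $K_n$. Let $STSP(n)=\operatorname{Conv}(A_n)$ be the symmetric traveling salesman polytope, regarded as a convex body in the vector space $E_n$ obtained from the affine span of $A_n$ by taking the average of the elements of $A_n$ as origin. Define the two-tier TSP polytope $$2TSP(n)=STSP(n)\otimes STSP(n):=\operatorname{Conv}\{(p,q,p\otimes q): p,q\in STSP(n)\}\subseteq E_n\times E_n\times(E_n\otimes E_n)$$ and, for an integer $m>0$, the Roman army TSP polytope $$RTSP(m,n)=\operatorname{Sym}^m(STSP(n)):=\operatorname{Conv}\{(e_1(p_1,\dots,p_m),\dots,e_m(p_1,\dots,p_m)): p_i\in STSP(n)\}\subseteq\prod_{j=1}^m\operatorname{Sym}^j(E_n),$$ where $e_j$ is the $j$-th elementary symmetric polynomial in $m$ variables, evaluated in the symmetric algebra of $E_n$. **Theorem.** For every integer $d\ge 0$ there is an integer $N(d)>0$ such that, for every $n\ge N(d)$ and every $\{0,1\}$-polytope $P\subseteq\mathbb{R}^d$ (i.e. every polytope all of whose vertices have all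 their components in $\{0,1\}$), the polytope $P$ is affinely isomorphic to a face of $2TSP(n)$ and, for every integer $m>1$, to a face of $RTSP(m,n)$. Here two polytopes are affinely isomorphic if some affine map between their ambient spaces restricts to a bijection between them, and a face of a polytope $C$ is a convex subset $F\subseteq C$ such that whenever a point of $F$ lies in the relative interior of a segment contained in $C$, both end points of the segment lie in $F$. -/

import Mathlib

open scoped TensorProduct

/-- `P ⊆ ℝ^d` is a `{0,1}`-polytope: the convex hull of finitely many points, all of whose
vertices (extreme points) have all components in `{0,1}`. -/
def IsZeroOnePolytope {d : ℕ} (P : Set (Fin d → ℝ)) : Prop :=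
  (∃ S : Finset (Fin d → ℝ), P = convexHull ℝ (S : Set (Fin d → ℝ))) ∧
    ∀ x ∈ P.extremePoints ℝ, ∀ i, x i = 0 ∨ x i = 1

/-- `F` is a face of the convex set `C`: a convex subset that contains both end points of every
segment of `C` having a relative interior point in `F`. The empty set and `C` are faces. -/
def IsFaceOf {V : Type*} [AddCommGroup V] [Module ℝ V] (C F : Set V) : Prop :=
  Convex ℝ F ∧ IsExtreme ℝ C F

/-- Affine isomorphism of convex sets: some affine map of the ambient spaces restricts to a
bijection between them. -/
def AffinelyIsomorphic {V W : Type*} [AddCommGroup V] [Module ℝ V] [AddCommGroup W] [Module ℝ W]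
    (P : Set V) (Q : Set W) : Prop :=
  ∃ f : V →ᵃ[ℝ] W, Set.BijOn f P Q

/-- The tensor product of convex bodies,
`P ⊗ Q = Conv {(p, q, p ⊗ q) : p ∈ P, q ∈ Q} ⊆ E × E' × (E ⊗ E')`. -/
def convexTensor {E E' : Type*} [AddCommGroup E] [Module ℝ E] [AddCommGroup E'] [Module ℝ E']
    (P : Set E) (Q : Set E') : Set (E × E' × (E ⊗[ℝ] E')) :=
  convexHull ℝ {z | ∃ p ∈ P, ∃ q ∈ Q, z = (p, q, p ⊗ₜ[ℝ] q)}

/-- The element `e_j(p₁, …, p_m)` of `Sym^j(E)`, the degree `j` part of the symmetric algebra of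
`E`, where `e_j` is the `j`-th elementary symmetric polynomial in `m` variables. -/
noncomputable def symElem {E : Type*} [AddCommGroup E] [Module ℝ E] {m : ℕ} (p : Fin m → E)
    (j : ℕ) : SymmetricAlgebra ℝ E :=
  MvPolynomial.aeval (fun i => SymmetricAlgebra.ι ℝ E (p i)) (MvPolynomial.esymm (Fin m) ℝ j)

/-- The `m`-th symmetric power of a convex body,
`Sym^m(P) = Conv {(e₁(p₁, …, p_m), …, e_m(p₁, …, p_m)) : p_i ∈ P} ⊆ ∏_{j=1}^m Sym^j(E)`,
each `Sym^j(E)` being regarded as a subspace of the symmetric algebra. The coordinate with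
index `j : Fin m` is the one of degree `j + 1`. -/
def convexSym (m : ℕ) {E : Type*} [AddCommGroup E] [Module ℝ E] (P : Set E) :
    Set (Fin m → SymmetricAlgebra ℝ E) :=
  convexHull ℝ {z | ∃ p : Fin m → E, (∀ i, p i ∈ P) ∧ z = fun j : Fin m => symElem p (j.val + 1)}

open Classical in
/-- The adjacency matrices of the Hamiltonian cycles of the complete graph on `n` vertices. -/
def tourMatrices (n : ℕ) : Set (Matrix (Fin n) (Fin n) ℝ) :=
  {A | ∃ (v : Fin n) (p : (⊤ : SimpleGraph (Fin n)).Walk v v),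
    p.IsHamiltonianCycle ∧ A = p.toSubgraph.spanningCoe.adjMatrix ℝ}

open Classical in
theorem finite_tourMatrices (n : ℕ) : (tourMatrices n).Finite := by
  refine (Set.finite_range fun G : SimpleGraph (Fin n) => G.adjMatrix ℝ).subset ?_
  rintro A ⟨v, p, -, rfl⟩
  exact ⟨_, rfl⟩

/-- The average of the vertices of the symmetric traveling salesman polytope. -/
noncomputable def tourCenter (n : ℕ) : Matrix (Fin n) (Fin n) ℝ :=
  (finite_tourMatrices n).toFinset.centroid ℝ id

/-- The symmetric traveling salesman polytope `STSP(n)`, the convex hull of the tour matrices,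
as a convex body in its affine span with the average of the vertices as origin; this affine span
is thereby identified with its direction `vectorSpan ℝ (tourMatrices n)`. -/
def STSP (n : ℕ) : Set (vectorSpan ℝ (tourMatrices n)) :=
  {x | (x : Matrix (Fin n) (Fin n) ℝ) + tourCenter n ∈ convexHull ℝ (tourMatrices n)}

/-- The two-tier traveling salesman polytope `STSP(n) ⊗ STSP(n)`. -/
def twoTierTSP (n : ℕ) : Set (vectorSpan ℝ (tourMatrices n) × vectorSpan ℝ (tourMatrices n) ×
    (vectorSpan ℝ (tourMatrices n) ⊗[ℝ] vectorSpan ℝ (tourMatrices n))) :=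
  convexTensor (STSP n) (STSP n)

/-- The Roman army traveling salesman polytope `Sym^m(STSP(n))`. -/
def romanTSP (m n : ℕ) : Set (Fin m → SymmetricAlgebra ℝ (vectorSpan ℝ (tourMatrices n))) :=
  convexSym m (STSP n)

/-! Everything reduces to one copy of STSP(n): for large n, P is affinely isomorphic to a face F of
STSP(n) itself. Take a tour q in F, a valid inequality h ≥ 0 whose zeros are F, and a valid
inequality g ≥ 0 whose only zero is q. On generators of the tensor product, h(p) + g(r) vanishes
exactly when p ∈ F and r = q, and p ↦ (p, q, p ⊗ q) is affine and injective
(`exists_face_convexTensor`). On generators of the symmetric power, ∑ h(p_i) + ∑_{i≠j} g(p_i) g(p_j)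
is an affine function of e₁ and e₂; it vanishes exactly when all p_i lie in F and all but at most
one equal q, and the e_j depend affinely and injectively on the remaining point
(`exists_face_convexSym`).

To realize P = Conv(S), with S a set of cube vertices, as a face of STSP(n), it suffices to find a
graph on n vertices whose Hamiltonian cycles are affinely parametrized by S: vanishing on the
non-edges cuts out a face. By Barrington's theorem (`exists_program`), membership in S is decided by
a product of permutations of five points, each chosen by one bit, which is a five-cycle on S and the
identity off S. Arrange the instructions as cyclically ordered layers of five vertices. A tour must
choose one permutation per layer (`eq_or_eq_of_forall_eq_or_eq`), and a choice is a tour when the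
product is a five-cycle and is not when the product is trivial. Three-vertex gadgets
(`TourModel.sync`) force instructions that read the same variable to receive the same bit.

Replacing each vertex by a directed path with at least three vertices makes the directions of the
arcs superfluous (`pathArc_of_pathArc`); lengthening one path gives every large n. As d is fixed,
only finitely many S occur, so one bound serves them all. -/

/-- A self-map of a finite set whose functional graph is a single directed cycle through all
the points. -/
def IsTour {V : Type*} (f : V → V) : Prop :=
  ∀ s : Set V, s.Nonempty → (∀ x ∈ s, f x ∈ s) → s = Set.univ

/-! ### Tours as self-maps without proper nonempty invariant sets -/

namespace IsTour

variable {V W : Type*} {f : V → V}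

theorem forall_of_closed (hf : IsTour f) {p : V → Prop} {x : V} (hx : p x)
    (hp : ∀ x, p x → p (f x)) (y : V) : p y := by
  have := hf {x | p x} ⟨x, hx⟩ hp
  exact this.ge (Set.mem_univ y)

theorem surjective (hf : IsTour f) : Function.Surjective f := by
  intro y
  exact hf.forall_of_closed (p := fun z => z ∈ Set.range f) ⟨y, rfl⟩ (fun x _ => ⟨x, rfl⟩) y

theorem injective [Finite V] (hf : IsTour f) : Function.Injective f :=
  Finite.injective_iff_surjective.mpr hf.surjective

theorem exists_iterate (hf : IsTour f) (x y : V) : ∃ k : ℕ, f^[k] x = y :=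
  hf.forall_of_closed (p := fun z => ∃ k : ℕ, f^[k] x = z) (x := x) ⟨0, rfl⟩
    (fun _ ⟨k, hk⟩ => ⟨k + 1, by rw [Function.iterate_succ_apply', hk]⟩) y

theorem apply_ne_self [Nontrivial V] (hf : IsTour f) (x : V) : f x ≠ x := by
  intro h
  obtain ⟨y, hy⟩ := exists_ne x
  exact hy (hf.forall_of_closed (p := fun z => z = x) rfl (fun z hz => by rw [hz, h]) y)

theorem apply_apply_ne_self [Finite V] (hV : 3 ≤ Nat.card V) (hf : IsTour f) (x : V) :
    f (f x) ≠ x := by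
  intro h
  have huniv : ({x, f x} : Set V) = Set.univ := by
    refine hf _ ⟨x, by simp⟩ ?_
    rintro y (rfl | rfl)
    · simp
    · simp [h]
  have h1 := Set.ncard_univ V
  have h2 := Set.ncard_insert_le x {f x}
  rw [Set.ncard_singleton, huniv, h1] at h2
  omega

/-- The complement of a `g`-invariant set is `f`-invariant: if `f z` lies in the set, so does `g (f
z) = z`. -/
theorem of_leftInverse {g : V → V} (hf : IsTour f) (hg : Function.LeftInverse g f) :
    IsTour g := by
  intro s hs hcl
  by_contra hne
  obtain ⟨x, hx⟩ := (Set.ne_univ_iff_exists_notMem s).mp hne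
  obtain ⟨y, hy⟩ := hs
  exact hf.forall_of_closed (p := fun z => z ∉ s) hx
    (fun z hz h => hz (by simpa [hg z] using hcl _ h)) y hy

theorem of_semiconj {g : W → W} (hf : IsTour f) {e : V → W} (he : Function.Surjective e)
    (h : ∀ x, e (f x) = g (e x)) : IsTour g := by
  intro s hs hcl
  obtain ⟨y, hy⟩ := hs
  obtain ⟨x, rfl⟩ := he y
  refine Set.eq_univ_of_forall fun z => ?_
  obtain ⟨z, rfl⟩ := he z
  exact hf.forall_of_closed (p := fun z => e z ∈ s) hy (fun z hz => by rw [h]; exact hcl _ hz) z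

theorem conj_iff (e : V ≃ W) : IsTour (fun y => e (f (e.symm y))) ↔ IsTour f :=
  ⟨fun h => h.of_semiconj e.symm.surjective (by simp),
    fun h => h.of_semiconj e.surjective (by simp)⟩

/-- Subdividing the arc leaving `u` by the three vertices `inr p`, `inr q`, `inr r` does not
affect being a tour. -/
theorem insert_iff {u : V} {g : V ⊕ Fin 3 → V ⊕ Fin 3} {p q r : Fin 3}
    (hpqr : ∀ i, i = p ∨ i = q ∨ i = r) (hg : ∀ v, v ≠ u → g (.inl v) = .inl (f v))
    (hu : g (.inl u) = .inr p) (hp : g (.inr p) = .inr q) (hq : g (.inr q) = .inr r)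
    (hr : g (.inr r) = .inl (f u)) : IsTour g ↔ IsTour f := by
  constructor
  · rintro h s ⟨x, hx⟩ hcl
    refine Set.eq_univ_of_forall fun y => ?_
    have := h.forall_of_closed (p := fun z => Sum.elim (· ∈ s) (fun _ => u ∈ s) z)
      (x := .inl x) hx ?_ (.inl y)
    · exact this
    · rintro (v | i) hz
      · by_cases hv : v = u
        · subst hv
          rw [hu]
          exact hz
        · rw [hg v hv]
          exact hcl _ hz
      · rcases hpqr i with rfl | rfl | rfl
        · rw [hp]; exact hz
        · rw [hq]; exact hz
        · rw [hr]; exact hcl _ hz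
  · rintro h s ⟨x, hx⟩ hcl
    have hr' : Sum.inr r ∈ s → Sum.inl (f u) ∈ s := fun hz => hr ▸ hcl _ hz
    have hq' : Sum.inr q ∈ s → Sum.inr r ∈ s := fun hz => hq ▸ hcl _ hz
    have hp' : Sum.inr p ∈ s → Sum.inr q ∈ s := fun hz => hp ▸ hcl _ hz
    have hu' : Sum.inl u ∈ s → Sum.inr p ∈ s := fun hz => hu ▸ hcl _ hz
    have hv : ∃ v, Sum.inl v ∈ s := by
      rcases x with v | i
      · exact ⟨v, hx⟩
      · refine ⟨f u, ?_⟩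
        rcases hpqr i with rfl | rfl | rfl <;> tauto
    obtain ⟨v, hv⟩ := hv
    have hall : ∀ w, Sum.inl w ∈ s := by
      refine h.forall_of_closed (p := fun w => Sum.inl w ∈ s) hv fun w hw => ?_
      by_cases hwu : w = u
      · subst hwu; tauto
      · rw [← hg w hwu]; exact hcl _ hw
    refine Set.eq_univ_of_forall ?_
    rintro (w | i)
    · exact hall w
    · have := hall u
      rcases hpqr i with rfl | rfl | rfl <;> tauto

end IsTour

/-! ### Barrington's theorem on width-five branching programs -/

/-- The cyclic permutation `(0 1 2 3 4)`. -/
abbrev fiveCycle : Equiv.Perm (Fin 5) := finRotate 5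

theorem isTour_fiveCycle : IsTour fiveCycle := by
  intro s ⟨x, hx⟩ hcl
  have h1 := hcl _ hx
  have h2 := hcl _ h1
  have h3 := hcl _ h2
  have h4 := hcl _ h3
  refine Set.eq_univ_of_forall fun y => ?_
  have : y = x ∨ y = fiveCycle x ∨ y = fiveCycle (fiveCycle x) ∨
      y = fiveCycle (fiveCycle (fiveCycle x)) ∨
      y = fiveCycle (fiveCycle (fiveCycle (fiveCycle x))) := by
    clear h1 h2 h3 h4 hx hcl
    revert x y
    decide
  rcases this with rfl | rfl | rfl | rfl | rfl <;> assumption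

theorem isTour_of_isConj_fiveCycle {g : Equiv.Perm (Fin 5)} (hg : IsConj fiveCycle g) :
    IsTour g := by
  obtain ⟨k, rfl⟩ := isConj_iff.mp hg
  exact (IsTour.conj_iff k).mpr isTour_fiveCycle

theorem isConj_fiveCycle_inv_self : IsConj fiveCycle fiveCycle⁻¹ :=
  isConj_iff.mpr ⟨⟨![0, 4, 3, 2, 1], ![0, 4, 3, 2, 1], by decide, by decide⟩,
    Equiv.ext (by decide)⟩

theorem isConj_fiveCycle_inv {g : Equiv.Perm (Fin 5)} (hg : IsConj fiveCycle g) :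
    IsConj fiveCycle g⁻¹ := by
  obtain ⟨k, rfl⟩ := isConj_iff.mp hg
  refine isConj_fiveCycle_inv_self.trans (isConj_iff.mpr ⟨k, by group⟩)

/-- One explicit pair of conjugates of `fiveCycle` has commutator `fiveCycle`; conjugating the pair
by `k` handles every five-cycle. This is what makes width five suffice for conjunctions. -/
theorem exists_commutator_eq_of_isConj_fiveCycle {g : Equiv.Perm (Fin 5)}
    (hg : IsConj fiveCycle g) :
    ∃ a b, IsConj fiveCycle a ∧ IsConj fiveCycle b ∧ a * b * a⁻¹ * b⁻¹ = g := by
  obtain ⟨k, rfl⟩ := isConj_iff.mp hg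
  let u : Equiv.Perm (Fin 5) := ⟨![0, 2, 1, 4, 3], ![0, 2, 1, 4, 3], by decide, by decide⟩
  let v : Equiv.Perm (Fin 5) := ⟨![0, 1, 4, 2, 3], ![0, 1, 3, 4, 2], by decide, by decide⟩
  have h : (u * fiveCycle * u⁻¹) * (v * fiveCycle * v⁻¹) * (u * fiveCycle * u⁻¹)⁻¹ *
      (v * fiveCycle * v⁻¹)⁻¹ = fiveCycle := Equiv.ext (by decide)
  refine ⟨(k * u) * fiveCycle * (k * u)⁻¹, (k * v) * fiveCycle * (k * v)⁻¹,
    isConj_iff.mpr ⟨_, rfl⟩, isConj_iff.mpr ⟨_, rfl⟩, ?_⟩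
  calc _ = k * ((u * fiveCycle * u⁻¹) * (v * fiveCycle * v⁻¹) * (u * fiveCycle * u⁻¹)⁻¹ *
      (v * fiveCycle * v⁻¹)⁻¹) * k⁻¹ := by group
    _ = _ := by rw [h]

/-- An instruction of a permutation branching program of width five: a variable together with
the permutations to be used when its value is `false` and `true`, respectively. -/
structure PermInstr (J : Type*) where
  /-- The variable that is read. -/
  var : J
  /-- The permutations for the two values of the variable. -/
  perm : Bool → Equiv.Perm (Fin 5)
  /-- The two permutations differ by a five-cycle. -/
  isTour : IsTour ((perm false)⁻¹ * perm true)

/-- The product computed by a permutation branching program. -/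
def evalProgram {J : Type*} (L : List (PermInstr J)) (x : J → Bool) : Equiv.Perm (Fin 5) :=
  (L.map fun i => i.perm (x i.var)).prod

theorem evalProgram_append {J : Type*} (L L' : List (PermInstr J)) (x : J → Bool) :
    evalProgram (L ++ L') x = evalProgram L x * evalProgram L' x := by
  simp [evalProgram]

open Classical in
theorem exists_program_literal {J : Type*} (l : J × Bool) {g : Equiv.Perm (Fin 5)}
    (hg : IsConj fiveCycle g) :
    ∃ L : List (PermInstr J), (∃ i ∈ L, i.var = l.1) ∧
      ∀ x, evalProgram L x = if x l.1 = l.2 then g else 1 := by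
  obtain ⟨j, b⟩ := l
  have hinv := isTour_of_isConj_fiveCycle (isConj_fiveCycle_inv hg)
  cases b
  · exact ⟨[⟨j, fun b => if b = false then g else 1, by simpa using hinv⟩], by simp,
      fun x => by simp [evalProgram]⟩
  · exact ⟨[⟨j, fun b => if b = true then g else 1,
      by simpa using isTour_of_isConj_fiveCycle hg⟩], by simp, fun x => by simp [evalProgram]⟩

open Classical in
-- A commutator acts as AND: if the program for `a` or the one for `b` yields the identity, the
-- commutator collapses to the identity, and otherwise it is the prescribed five-cycle. The target
-- `g` is universally quantified because the induction needs the factors and their inverses.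
theorem exists_program_conjunction {J : Type*} (l : J × Bool) (ls : List (J × Bool)) :
    ∀ {g : Equiv.Perm (Fin 5)}, IsConj fiveCycle g →
    ∃ L : List (PermInstr J), (∀ l' ∈ l :: ls, ∃ i ∈ L, i.var = l'.1) ∧
      ∀ x, evalProgram L x = if ∀ l' ∈ l :: ls, x l'.1 = l'.2 then g else 1 := by
  induction ls generalizing l with
  | nil =>
    intro g hg
    simpa using exists_program_literal l hg
  | cons l' ls ih =>
    intro g hg
    obtain ⟨a, b, ha, hb, rfl⟩ := exists_commutator_eq_of_isConj_fiveCycle hg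
    obtain ⟨A, hA, hAe⟩ := exists_program_literal l ha
    obtain ⟨A', -, hAe'⟩ := exists_program_literal l (isConj_fiveCycle_inv ha)
    obtain ⟨B, hB, hBe⟩ := ih l' hb
    obtain ⟨B', -, hBe'⟩ := ih l' (isConj_fiveCycle_inv hb)
    refine ⟨A ++ B ++ A' ++ B', ?_, fun x => ?_⟩
    · intro m hm
      rcases List.mem_cons.mp hm with rfl | hm
      · obtain ⟨i, hi, hi'⟩ := hA
        exact ⟨i, by simp [hi], hi'⟩
      · obtain ⟨i, hi, hi'⟩ := hB m hm
        exact ⟨i, by simp [hi], hi'⟩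
    · simp only [evalProgram_append, hAe, hAe', hBe, hBe', List.forall_mem_cons (a := l)]
      by_cases h1 : x l.1 = l.2
      · by_cases h2 : ∀ m ∈ l' :: ls, x m.1 = m.2
        · simp only [if_pos h1, if_pos h2, if_pos (And.intro h1 h2)]
        · simp only [if_pos h1, if_neg h2, if_neg (fun h : _ ∧ _ => h2 h.2), mul_one,
            mul_inv_cancel]
      · by_cases h2 : ∀ m ∈ l' :: ls, x m.1 = m.2
        · simp only [if_neg h1, if_pos h2, if_neg (fun h : _ ∧ _ => h1 h.1), mul_one, one_mul,
            mul_inv_cancel]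
        · simp only [if_neg h1, if_neg h2, if_neg (fun h : _ ∧ _ => h1 h.1), mul_one]

open Classical in
/-- Barrington's theorem: every Boolean function that is not identically false is computed by a
permutation branching program of width five which reads all variables. -/
theorem exists_program {J : Type*} [Fintype J] [Nonempty J] (S : Finset (J → Bool))
    (hS : S.Nonempty) :
    ∃ L : List (PermInstr J), (∀ j, ∃ i ∈ L, i.var = j) ∧
      ∀ x, evalProgram L x = if x ∈ S then fiveCycle else 1 := by
  have point : ∀ s : J → Bool, ∃ L : List (PermInstr J), (∀ j, ∃ i ∈ L, i.var = j) ∧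
      ∀ x, evalProgram L x = if x = s then fiveCycle else 1 := by
    intro s
    obtain ⟨j₀⟩ := ‹Nonempty J›
    -- The literal of `j₀` is listed a second time in front because the conjunction lemma needs a
    -- nonempty list.
    obtain ⟨L, hL, hLe⟩ := exists_program_conjunction (j₀, s j₀)
      (Finset.univ.toList.map fun j => (j, s j)) (IsConj.refl fiveCycle)
    refine ⟨L, fun j => hL (j, s j) (by simp), fun x => ?_⟩
    rw [hLe]
    congr 1
    simp only [List.mem_cons, List.mem_map, Finset.mem_toList, Finset.mem_univ, true_and,
      eq_iff_iff, funext_iff]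
    constructor
    · exact fun h j => h (j, s j) (Or.inr ⟨j, rfl⟩)
    · rintro h l (rfl | ⟨j, rfl⟩) <;> exact h _
  induction hS using Finset.Nonempty.cons_induction with
  | singleton s => simpa using point s
  | cons s S hs _ ih =>
    obtain ⟨L, hL, hLe⟩ := ih
    obtain ⟨L', -, hLe'⟩ := point s
    -- Since `s ∉ S`, at most one of the two factors is nontrivial on a given input, so
    -- concatenation acts as OR.
    refine ⟨L ++ L', fun j => ?_, fun x => ?_⟩
    · obtain ⟨i, hi, hi'⟩ := hL j
      exact ⟨i, by simp [hi], hi'⟩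
    · rw [evalProgram_append, hLe, hLe']
      by_cases h : x = s
      · subst h
        simp [hs]
      · simp [h]

/-! ### Digraphs whose tours are parametrized by Boolean vectors -/

/-- The vertex of the unit cube corresponding to a Boolean vector. -/
def cubeVertex {I : Type*} (y : I → Bool) : I → ℝ := fun i => if y i = true then 1 else 0

open Classical in
/-- A digraph `(V, arc)` whose Hamiltonian cycles are parametrized by `X ⊆ {0,1}^I` in such a way
that the incidence vector of a cycle is an affine function of the parameter and that every
literal `(i, b)` is represented by an arc, which belongs to the cycle with parameter `y` if and
only if `y i = b`. -/
structure TourModel (I : Type*) (X : Set (I → Bool)) where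
  /-- The vertices. -/
  V : Type
  /-- There are finitely many vertices. -/
  fintype : Fintype V
  /-- The arcs. -/
  arc : V → V → Prop
  /-- The Hamiltonian cycle with a given parameter. -/
  tour : (I → Bool) → V → V
  /-- The arcs representing the literals. -/
  lit : I × Bool → V × V
  lit_injective : Function.Injective lit
  isTour_tour : ∀ y ∈ X, IsTour (tour y)
  arc_tour : ∀ y ∈ X, ∀ v, arc v (tour y v)
  eq_tour : ∀ f : V → V, IsTour f → (∀ v, arc v (f v)) → ∃ y ∈ X, f = tour y
  affine : ∀ v w, ∃ φ : (I → ℝ) →ᵃ[ℝ] ℝ, ∀ y ∈ X,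
    (if tour y v = w then 1 else 0) = φ (cubeVertex y)
  lit_iff : ∀ y ∈ X, ∀ l, tour y (lit l).1 = (lit l).2 ↔ y l.1 = l.2

theorem exists_affine_of_coord {I : Type*} (i : I) (c : Bool → ℝ) :
    ∃ φ : (I → ℝ) →ᵃ[ℝ] ℝ, ∀ y : I → Bool, c (y i) = φ (cubeVertex y) := by
  refine ⟨(c true - c false) • (LinearMap.proj i : (I → ℝ) →ₗ[ℝ] ℝ).toAffineMap +
    AffineMap.const ℝ _ (c false), fun y => ?_⟩
  cases h : y i <;> simp [cubeVertex, h]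

namespace TourModel

/-- The parameters of a model may be replaced by others of which they are copies. -/
def reindex {I J : Type*} {X : Set (I → Bool)} {S : Set (J → Bool)} (M : TourModel I X)
    (var : I → J) (sec : J → I) (hsec : ∀ j, var (sec j) = j)
    (hX : ∀ y, y ∈ X ↔ ∃ x ∈ S, y = x ∘ var) : TourModel J S where
  V := M.V
  fintype := M.fintype
  arc := M.arc
  tour x := M.tour (x ∘ var)
  lit l := M.lit (sec l.1, l.2)
  lit_injective := by
    intro l l' h
    have := M.lit_injective h
    rw [Prod.mk.injEq] at this
    exact Prod.ext (by rw [← hsec l.1, this.1, hsec]) this.2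
  isTour_tour x hx := M.isTour_tour _ ((hX _).mpr ⟨x, hx, rfl⟩)
  arc_tour x hx := M.arc_tour _ ((hX _).mpr ⟨x, hx, rfl⟩)
  eq_tour f hf hf' := by
    obtain ⟨y, hy, rfl⟩ := M.eq_tour f hf hf'
    obtain ⟨x, hx, rfl⟩ := (hX _).mp hy
    exact ⟨x, hx, rfl⟩
  affine v w := by
    obtain ⟨φ, hφ⟩ := M.affine v w
    exact ⟨φ.comp (LinearMap.funLeft ℝ ℝ var).toAffineMap,
      fun x hx => hφ _ ((hX _).mpr ⟨x, hx, rfl⟩)⟩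
  lit_iff x hx l := by
    rw [M.lit_iff _ ((hX _).mpr ⟨x, hx, rfl⟩)]
    simp [hsec]

/-! ### Forcing two parameters to agree -/

section Sync

variable {I : Type*} {X : Set (I → Bool)} (M : TourModel I X) (i j : I)

/-- The arcs obtained by routing the arcs representing `i = true` and `j = false` through the
vertices `0`, `1`, `2` and `2`, `1`, `0`, respectively. -/
def syncArc : M.V ⊕ Fin 3 → M.V ⊕ Fin 3 → Prop
  | .inl v, .inl w => M.arc v w ∧ (v, w) ≠ M.lit (i, true) ∧ (v, w) ≠ M.lit (j, false)
  -- A literal is not assumed to be an arc for every model, so `M.arc` is demanded here; otherwise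
  -- contracting the gadget could create a new arc.
  | .inl v, .inr k => (k = 0 ∧ v = (M.lit (i, true)).1 ∧
        M.arc (M.lit (i, true)).1 (M.lit (i, true)).2) ∨
      (k = 2 ∧ v = (M.lit (j, false)).1 ∧ M.arc (M.lit (j, false)).1 (M.lit (j, false)).2)
  | .inr k, .inl w => (k = 2 ∧ w = (M.lit (i, true)).2) ∨ (k = 0 ∧ w = (M.lit (j, false)).2)
  | .inr k, .inr k' => k ≠ k' ∧ (k = 1 ∨ k' = 1)

open Classical in
/-- The Hamiltonian cycles of the new digraph. -/
noncomputable def syncTour (y : I → Bool) : M.V ⊕ Fin 3 → M.V ⊕ Fin 3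
  | .inl v => if y i = true then
      if v = (M.lit (i, true)).1 then .inr 0 else .inl (M.tour y v)
    else if v = (M.lit (j, false)).1 then .inr 2 else .inl (M.tour y v)
  | .inr k => if y i = true then ![.inr 1, .inr 2, .inl (M.lit (i, true)).2] k
    else ![.inl (M.lit (j, false)).2, .inr 0, .inr 1] k

variable {M i j}

theorem isTour_syncTour {y : I → Bool} (hy : y ∈ X) (hij : y i = y j) :
    IsTour (M.syncTour i j y) := by
  have hM := M.lit_iff y hy
  by_cases h : y i = true
  · have hi := (hM (i, true)).mpr h
    refine (IsTour.insert_iff (f := M.tour y) (u := (M.lit (i, true)).1) (p := 0) (q := 1)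
      (r := 2) (by decide) ?_ ?_ ?_ ?_ ?_).mpr (M.isTour_tour y hy) <;>
      simp +contextual [syncTour, h, hi]
  · have hi := (hM (j, false)).mpr (by simpa [← hij] using h)
    refine (IsTour.insert_iff (f := M.tour y) (u := (M.lit (j, false)).1) (p := 2) (q := 1)
      (r := 0) (by decide) ?_ ?_ ?_ ?_ ?_).mpr (M.isTour_tour y hy) <;>
      simp +contextual [syncTour, h, hi]

theorem syncArc_syncTour {y : I → Bool} (hy : y ∈ X) (hij : y i = y j) (v : M.V ⊕ Fin 3) :
    M.syncArc i j v (M.syncTour i j y v) := by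
  have hM := M.lit_iff y hy
  have harc := M.arc_tour y hy
  by_cases h : y i = true
  · have hi := (hM (i, true)).mpr h
    have hj : M.tour y (M.lit (j, false)).1 ≠ (M.lit (j, false)).2 := by
      rw [Ne, hM]; simp [← hij, h]
    rcases v with v | k
    · by_cases hv : v = (M.lit (i, true)).1
      · simp only [syncTour, h, hv, if_true, syncArc]
        exact Or.inl ⟨trivial, trivial, by simpa [hi] using harc (M.lit (i, true)).1⟩
      · simp only [syncTour, h, hv, if_true, if_false, syncArc]
        refine ⟨harc v, fun h' => hv (by rw [← h']), fun h' => hj ?_⟩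
        rw [← h']
    · fin_cases k <;> simp [syncTour, h, syncArc]
  · have hi := (hM (j, false)).mpr (by simpa [← hij] using h)
    have hj : M.tour y (M.lit (i, true)).1 ≠ (M.lit (i, true)).2 := by
      rw [Ne, hM]; simp [h]
    rcases v with v | k
    · by_cases hv : v = (M.lit (j, false)).1
      · simp only [syncTour, h, hv, if_true, syncArc]
        exact Or.inr ⟨rfl, rfl, by simpa [hi] using harc (M.lit (j, false)).1⟩
      · simp only [syncTour, h, hv, if_false, syncArc]
        refine ⟨harc v, fun h' => hj ?_, fun h' => hv (by rw [← h'])⟩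
        rw [← h']
    · fin_cases k <;> simp [syncTour, h, syncArc]

/-- The step `q → r` forces the whole passage `u → p → q → r → t`: an arc `r → q` would close a
2-cycle, so `r` goes to `t`; then `q` can only be reached from `p`, and `p` only from `u`.
Contracting the passage leaves a tour of `V`. -/
theorem _root_.IsTour.exists_contraction {V : Type*} [Finite V] {g : V ⊕ Fin 3 → V ⊕ Fin 3}
    (hg : IsTour g) {p q r : Fin 3} (hpqr : ∀ i, i = p ∨ i = q ∨ i = r) (hpr : p ≠ r) {u t : V}
    (hq : g (.inr q) = .inr r) (hq' : ∀ z, g z = .inr q → z = .inr p ∨ z = .inr r)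
    (hr : g (.inr r) = .inl t ∨ g (.inr r) = .inr q)
    (hp : ∀ z, g z = .inr p → z = .inl u ∨ z = .inr q) :
    ∃ f : V → V, IsTour f ∧ f u = t ∧ g (.inl u) = .inr p ∧ g (.inr p) = .inr q ∧
      g (.inr r) = .inl t ∧ ∀ v, v ≠ u → g (.inl v) = .inl (f v) := by
  classical
  have hinj := hg.injective
  have hrt : g (.inr r) = .inl t := by
    refine hr.resolve_right fun h => ?_
    have := hg.forall_of_closed (p := fun z => z = .inr q ∨ z = .inr r) (x := .inr q)
      (Or.inl rfl) (by rintro z (rfl | rfl) <;> simp [hq, h]) (.inl u)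
    simp at this
  have hpq : g (.inr p) = .inr q := by
    obtain ⟨z, hz⟩ := hg.surjective (.inr q)
    rcases hq' z hz with rfl | rfl
    · exact hz
    · simp [hrt] at hz
  have hup : g (.inl u) = .inr p := by
    obtain ⟨z, hz⟩ := hg.surjective (.inr p)
    rcases hp z hz with rfl | rfl
    · exact hz
    · rw [hq] at hz
      exact absurd (Sum.inr_injective hz).symm hpr
  have hinl : ∀ v, v ≠ u → ∃ w, g (.inl v) = .inl w := by
    intro v hv
    rcases h : g (.inl v) with w | k
    · exact ⟨w, rfl⟩
    · exfalso
      rcases hpqr k with rfl | rfl | rfl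
      · exact hv (Sum.inl_injective (hinj (h.trans hup.symm)))
      · exact Sum.inl_ne_inr (hinj (h.trans hpq.symm))
      · exact Sum.inl_ne_inr (hinj (h.trans hq.symm))
  choose! F hF using hinl
  have hF' : ∀ v, v ≠ u → g (.inl v) = .inl (if v = u then t else F v) := fun v hv => by
    rw [hF v hv, if_neg hv]
  refine ⟨fun v => if v = u then t else F v, ?_, if_pos rfl, hup, hpq, hrt, hF'⟩
  exact (IsTour.insert_iff hpqr hF' hup hpq hq (by simpa using hrt)).mp hg

/-- The middle vertex `1` is left towards `2` or towards `0`, and this fixes the direction in which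
the gadget is crossed. One direction uses the arc of `i = true`, the other that of `j = false`. The
literal not used cannot occur in the contracted tour, because its direct arc has been removed and
each vertex has only one successor. So both bits are true or both are false. -/
theorem eq_syncTour {g : M.V ⊕ Fin 3 → M.V ⊕ Fin 3} (hg : IsTour g)
    (harc : ∀ v, M.syncArc i j v (g v)) : ∃ y ∈ X, y i = y j ∧ g = M.syncTour i j y := by
  have := M.fintype
  have hne : M.lit (i, true) ≠ M.lit (j, false) := fun h => by
    simpa using M.lit_injective h
  have hone : ∀ z, g z = .inr 1 → z = .inr 0 ∨ z = .inr 2 := by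
    intro z hz
    have := hz ▸ harc z
    rcases z with v | k
    · simp [syncArc] at this
    · fin_cases k <;> simp [syncArc] at this ⊢
  have hmid : g (.inr 1) = .inr 2 ∨ g (.inr 1) = .inr 0 := by
    have := harc (.inr 1)
    rcases h : g (.inr 1) with v | k
    · simp [syncArc, h] at this
    · rw [h] at this
      fin_cases k <;> simp [syncArc] at this ⊢
  rcases hmid with h1 | h1
  · obtain ⟨f, hf, hfu, hgu, hg0, hg2, hgf⟩ := hg.exists_contraction (p := 0) (q := 1) (r := 2)
      (u := (M.lit (i, true)).1) (t := (M.lit (i, true)).2) (by decide) (by decide) h1 hone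
      (by
        have := harc (.inr 2)
        rcases h : g (.inr 2) with v | k
        · simp [syncArc, h] at this
          simp [this]
        · rw [h] at this
          fin_cases k <;> simp [syncArc] at this ⊢)
      (by
        intro z hz
        have := hz ▸ harc z
        rcases z with v | k
        · simp [syncArc] at this
          simp [this]
        · fin_cases k <;> simp [syncArc] at this ⊢)
    have hjn : f (M.lit (j, false)).1 ≠ (M.lit (j, false)).2 := by
      intro h
      by_cases hu : (M.lit (j, false)).1 = (M.lit (i, true)).1
      · exact hne (Prod.ext hu.symm (by rw [← hfu, ← hu, h]))
      · have := harc (.inl (M.lit (j, false)).1)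
        rw [hgf _ hu, h] at this
        exact this.2.2 rfl
    obtain ⟨y, hy, rfl⟩ := M.eq_tour f hf (fun v => by
      by_cases hv : v = (M.lit (i, true)).1
      · have := harc (.inl v)
        rw [hv, hgu] at this
        rw [hv, hfu]
        simpa [syncArc] using this
      · have := harc (.inl v)
        rw [hgf _ hv] at this
        exact this.1)
    have hyi : y i = true := (M.lit_iff y hy (i, true)).mp hfu
    have hyj : y j = true := by
      have := (M.lit_iff y hy (j, false)).not.mp hjn
      simpa using this
    refine ⟨y, hy, hyi.trans hyj.symm, funext ?_⟩
    rintro (v | k)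
    · by_cases hv : v = (M.lit (i, true)).1
      · subst hv
        simp [syncTour, hyi, hgu]
      · simp [syncTour, hyi, hv, hgf]
    · fin_cases k <;> simp [syncTour, hyi, hg0, h1, hg2]
  · obtain ⟨f, hf, hfu, hgu, hg0, hg2, hgf⟩ := hg.exists_contraction (p := 2) (q := 1) (r := 0)
      (u := (M.lit (j, false)).1) (t := (M.lit (j, false)).2) (by decide) (by decide) h1
      (fun z hz => (hone z hz).symm)
      (by
        have := harc (.inr 0)
        rcases h : g (.inr 0) with v | k
        · simp [syncArc, h] at this
          simp [this]
        · rw [h] at this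
          fin_cases k <;> simp [syncArc] at this ⊢)
      (by
        intro z hz
        have := hz ▸ harc z
        rcases z with v | k
        · simp [syncArc] at this
          simp [this]
        · fin_cases k <;> simp [syncArc] at this ⊢)
    have hjn : f (M.lit (i, true)).1 ≠ (M.lit (i, true)).2 := by
      intro h
      by_cases hu : (M.lit (i, true)).1 = (M.lit (j, false)).1
      · exact hne (Prod.ext hu (by rw [← hfu, ← hu, h]))
      · have := harc (.inl (M.lit (i, true)).1)
        rw [hgf _ hu, h] at this
        exact this.2.1 rfl
    obtain ⟨y, hy, rfl⟩ := M.eq_tour f hf (fun v => by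
      by_cases hv : v = (M.lit (j, false)).1
      · have := harc (.inl v)
        rw [hv, hgu] at this
        rw [hv, hfu]
        simpa [syncArc] using this
      · have := harc (.inl v)
        rw [hgf _ hv] at this
        exact this.1)
    have hyj : y j = false := (M.lit_iff y hy (j, false)).mp hfu
    have hyi : y i = false := by
      have := (M.lit_iff y hy (i, true)).not.mp hjn
      simpa using this
    refine ⟨y, hy, hyi.trans hyj.symm, funext ?_⟩
    rintro (v | k)
    · by_cases hv : v = (M.lit (j, false)).1
      · subst hv
        simp [syncTour, hyi, hgu]
      · simp [syncTour, hyi, hv, hgf]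
    · fin_cases k <;> simp [syncTour, hyi, hg0, h1, hg2]

open Classical in
/-- The arcs representing the literals after the arcs for `i = true` and `j = false` have been
subdivided. -/
noncomputable def syncLit (M : TourModel I X) (i j : I) (l : I × Bool) :
    (M.V ⊕ Fin 3) × (M.V ⊕ Fin 3) :=
  if l = (i, true) then (.inl (M.lit l).1, .inr 0)
  else if l = (j, false) then (.inl (M.lit l).1, .inr 2)
  else (.inl (M.lit l).1, .inl (M.lit l).2)

theorem syncLit_injective : Function.Injective (M.syncLit i j) := by
  intro l l' h
  unfold syncLit at h
  split_ifs at h with h1 h2 h3 h4 h5 h6 h7 h8 <;> simp_all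
  exact M.lit_injective (Prod.ext h.1 h.2)

theorem syncLit_iff {y : I → Bool} (hy : y ∈ X) (hij : y i = y j) (l : I × Bool) :
    M.syncTour i j y (M.syncLit i j l).1 = (M.syncLit i j l).2 ↔ y l.1 = l.2 := by
  have hM := M.lit_iff y hy
  unfold syncLit
  split_ifs with h1 h2
  · subst h1
    cases h : y i
    · by_cases hu : (M.lit (i, true)).1 = (M.lit (j, false)).1 <;> simp [syncTour, h, hu]
    · simp [syncTour, h]
  · subst h2
    rw [← hij]
    cases h : y i
    · simp [syncTour, h]
    · by_cases hu : (M.lit (j, false)).1 = (M.lit (i, true)).1 <;> simp [syncTour, h, hu]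
  · cases h : y i
    · simp only [syncTour, h, Bool.false_eq_true, if_false]
      split_ifs with h3
      · simp only [false_iff]
        intro h4
        have h5 := (hM l).mpr h4
        have h6 := (hM (j, false)).mpr (hij ▸ h)
        exact h2 (M.lit_injective (Prod.ext h3 (by rw [← h5, ← h6, h3])))
      · rw [Sum.inl_injective.eq_iff]
        exact hM l
    · simp only [syncTour, h, if_true]
      split_ifs with h3
      · simp only [false_iff]
        intro h4
        have h5 := (hM l).mpr h4
        have h6 := (hM (i, true)).mpr h
        exact h1 (M.lit_injective (Prod.ext h3 (by rw [← h5, ← h6, h3])))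
      · rw [Sum.inl_injective.eq_iff]
        exact hM l

open Classical in
-- Between old vertices the indicator is unchanged, or zero for the two subdivided arcs; at the
-- gadget it depends on the single bit `y i`.
theorem exists_affine_syncTour (v w : M.V ⊕ Fin 3) :
    ∃ φ : (I → ℝ) →ᵃ[ℝ] ℝ, ∀ y ∈ X, y i = y j →
      (if M.syncTour i j y v = w then 1 else 0) = φ (cubeVertex y) := by
  have key : (∃ c : Bool → ℝ, ∀ y ∈ X, y i = y j →
      (if M.syncTour i j y v = w then 1 else 0) = c (y i)) →
      ∃ φ : (I → ℝ) →ᵃ[ℝ] ℝ, ∀ y ∈ X, y i = y j →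
      (if M.syncTour i j y v = w then 1 else 0) = φ (cubeVertex y) := by
    rintro ⟨c, hc⟩
    obtain ⟨φ, hφ⟩ := exists_affine_of_coord i c
    exact ⟨φ, fun y hy hij => (hc y hy hij).trans (hφ y)⟩
  rcases v with v | k
  · rcases w with w | k
    · by_cases he : (v, w) = M.lit (i, true) ∨ (v, w) = M.lit (j, false)
      · refine key ⟨fun _ => 0, fun y hy hij => if_neg fun h => ?_⟩
        have := syncArc_syncTour hy hij (.inl v)
        rw [h] at this
        exact he.elim this.2.1 this.2.2
      · obtain ⟨φ, hφ⟩ := M.affine v w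
        refine ⟨φ, fun y hy hij => ?_⟩
        rw [← hφ y hy]
        congr 1
        rw [not_or] at he
        cases h : y i
        · have h6 := (M.lit_iff y hy (j, false)).mpr (hij ▸ h)
          simp only [syncTour, h, Bool.false_eq_true, if_false]
          split_ifs with h3
          · simp only [eq_iff_iff, false_iff]
            exact fun h4 => he.2 (Prod.ext h3 (by rw [← h6, ← h3, h4]))
          · rw [Sum.inl_injective.eq_iff]
        · have h6 := (M.lit_iff y hy (i, true)).mpr h
          simp only [syncTour, h, if_true]
          split_ifs with h3
          · simp only [eq_iff_iff, false_iff]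
            exact fun h4 => he.1 (Prod.ext h3 (by rw [← h6, ← h3, h4]))
          · rw [Sum.inl_injective.eq_iff]
    · refine key ⟨fun b => if (if b = true then v = (M.lit (i, true)).1 ∧ k = 0
        else v = (M.lit (j, false)).1 ∧ k = 2) then 1 else 0, fun y _ _ => ?_⟩
      congr 1
      cases h : y i
      · by_cases hv : v = (M.lit (j, false)).1 <;> simp [syncTour, h, hv, @eq_comm _ k]
      · by_cases hv : v = (M.lit (i, true)).1 <;> simp [syncTour, h, hv, @eq_comm _ k]
  · refine key ⟨fun b => if (if b = true then
      (![.inr 1, .inr 2, .inl (M.lit (i, true)).2] k : M.V ⊕ Fin 3)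
      else ![.inl (M.lit (j, false)).2, .inr 0, .inr 1] k) = w then 1 else 0, fun y _ _ => ?_⟩
    rfl

end Sync

/-- The submodel in which two parameters agree. -/
noncomputable def sync {I : Type*} {X : Set (I → Bool)} (M : TourModel I X) (i j : I) :
    TourModel I {y ∈ X | y i = y j} where
  V := M.V ⊕ Fin 3
  fintype := have := M.fintype; inferInstance
  arc := M.syncArc i j
  tour := M.syncTour i j
  lit := M.syncLit i j
  lit_injective := syncLit_injective
  isTour_tour _ hy := isTour_syncTour hy.1 hy.2
  arc_tour _ hy := syncArc_syncTour hy.1 hy.2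
  eq_tour g hg harc := by
    obtain ⟨y, hy, hyij, rfl⟩ := eq_syncTour hg harc
    exact ⟨y, ⟨hy, hyij⟩, rfl⟩
  affine v w := by
    obtain ⟨φ, hφ⟩ := exists_affine_syncTour (M := M) (i := i) (j := j) v w
    refine ⟨φ, fun y hy => ?_⟩
    convert hφ y hy.1 hy.2
  lit_iff _ hy := syncLit_iff hy.1 hy.2

theorem nonempty_syncAll {I : Type*} {X : Set (I → Bool)} (M : TourModel I X)
    (s : Finset (I × I)) :
    Nonempty (TourModel I {y ∈ X | ∀ p ∈ s, y p.1 = y p.2}) := by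
  classical
  induction s using Finset.induction_on with
  | empty => exact ⟨by simpa using M⟩
  | insert p s _ ih =>
    obtain ⟨N⟩ := ih
    have hset : {y ∈ X | ∀ q ∈ insert p s, y q.1 = y q.2} =
        {y ∈ {y ∈ X | ∀ q ∈ s, y q.1 = y q.2} | y p.1 = y p.2} := by
      ext y
      simp only [Finset.forall_mem_insert, Set.mem_ofPred_eq]
      tauto
    rw [hset]
    exact ⟨N.sync p.1 p.2⟩

end TourModel

/-! ### The layered digraph of a permutation branching program -/

/-- The cyclic predecessor in `Fin m`. -/
def prevLayer {m : ℕ} (l : Fin m) : Fin m :=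
  ⟨if l.val = 0 then m - 1 else l.val - 1, by have := l.isLt; split_ifs <;> omega⟩

/-- The map that moves from layer to layer, applying the given permutations. -/
def layeredMap {m : ℕ} (τ : Fin m → Equiv.Perm (Fin 5)) (v : Fin m × Fin 5) : Fin m × Fin 5 :=
  (prevLayer v.1, τ v.1 v.2)

theorem prod_take_ofFn_succ {m : ℕ} (τ : Fin m → Equiv.Perm (Fin 5)) (l : Fin m) :
    ((List.ofFn τ).take (l.val + 1)).prod = ((List.ofFn τ).take l.val).prod * τ l := by
  rw [List.prod_take_succ _ _ (by simp)]
  simp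

/-- Layers are visited in decreasing order, so that the permutations compose in the order of the
list product. The first return map to the last layer is then the full product, which is a tour of
the five points. -/
theorem isTour_layeredMap {m : ℕ} (hm : 0 < m) {τ : Fin m → Equiv.Perm (Fin 5)}
    (hτ : IsTour (List.ofFn τ).prod) : IsTour (layeredMap τ) := by
  rintro s ⟨⟨l₀, k₀⟩, h₀⟩ hcl
  let last : Fin m := ⟨m - 1, by omega⟩
  have descend : ∀ (n : ℕ) (hn : n < m) (k : Fin 5), (⟨n, hn⟩, k) ∈ s →
      (last, ((List.ofFn τ).take (n + 1)).prod k) ∈ s := by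
    intro n
    induction n with
    | zero =>
      intro hn k hk
      have := hcl _ hk
      rw [prod_take_ofFn_succ τ ⟨0, hn⟩]
      simpa [layeredMap, prevLayer] using this
    | succ n ih =>
      intro hn k hk
      have := ih (by omega) _ (by simpa [layeredMap, prevLayer] using hcl _ hk)
      rw [prod_take_ofFn_succ τ ⟨n + 1, hn⟩]
      simpa using this
  have hlast : ∀ k, (last, k) ∈ s := by
    refine hτ.forall_of_closed (p := fun k => (last, k) ∈ s) (descend _ l₀.isLt k₀ h₀)
      fun k hk => ?_
    have := descend _ last.isLt k hk
    rwa [show (last : ℕ) + 1 = m by simp only [last]; omega, List.take_of_length_le (by simp)]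
      at this
  -- Invariance now spreads downwards from the last layer, since every vertex is the image of one in
  -- the layer above.
  have hall : ∀ (n : ℕ) (hn : n < m) (k : Fin 5), (⟨m - 1 - n, by omega⟩, k) ∈ s := by
    intro n
    induction n with
    | zero => exact fun _ => hlast
    | succ n ih =>
      intro hn k
      have := hcl _ (ih (by omega) ((τ ⟨m - 1 - n, by omega⟩).symm k))
      have h0 : m - 1 - n ≠ 0 := by omega
      simp only [layeredMap, prevLayer, h0, if_false, Equiv.apply_symm_apply] at this
      exact this
  refine Set.eq_univ_of_forall fun ⟨l, k⟩ => ?_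
  have := hall (m - 1 - l) (by omega) k
  convert this using 3
  omega

/-- The point at which the orbit of a vertex next enters the last layer is an invariant when the
product is trivial, and it separates the vertices of a layer. -/
theorem not_isTour_layeredMap {m : ℕ} (hm : 0 < m) {τ : Fin m → Equiv.Perm (Fin 5)}
    (hτ : (List.ofFn τ).prod = 1) : ¬ IsTour (layeredMap τ) := by
  intro h
  let p : Fin m × Fin 5 → Fin 5 := fun v => ((List.ofFn τ).take (v.1.val + 1)).prod v.2
  have hp : ∀ v, p (layeredMap τ v) = p v := by
    rintro ⟨l, k⟩
    simp only [p, layeredMap]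
    rw [prod_take_ofFn_succ τ l]
    by_cases hl : l.val = 0
    · have : (prevLayer l).val + 1 = m := by simp [prevLayer, hl]; omega
      rw [this, List.take_of_length_le (by simp), hτ, hl]
      simp
    · have : (prevLayer l).val + 1 = l.val := by simp [prevLayer, hl]; omega
      rw [this]
      rfl
  let l₀ : Fin m := ⟨0, hm⟩
  have hconst := h.forall_of_closed (p := fun v => p v = p (l₀, 0)) (x := (l₀, 0)) rfl
    (fun v hv => (hp v).trans hv) (l₀, 1)
  have := Equiv.injective _ hconst
  simp at this

/-- If `τ` agrees with `B` at `k`, then at `A⁻¹ B k` the value of `A` is already taken by `τ k`, so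
`τ` must agree with `B` there as well. As `A⁻¹ * B` is a tour, this reaches every point. -/
theorem eq_or_eq_of_forall_eq_or_eq {A B : Equiv.Perm (Fin 5)} (h : IsTour (A⁻¹ * B))
    {τ : Fin 5 → Fin 5} (hinj : Function.Injective τ) (hτ : ∀ k, τ k = A k ∨ τ k = B k) :
    (∀ k, τ k = A k) ∨ ∀ k, τ k = B k := by
  by_cases hex : ∃ k, τ k = B k
  · obtain ⟨k, hk⟩ := hex
    refine Or.inr (h.forall_of_closed (p := fun k => τ k = B k) hk fun k hk => ?_)
    refine (hτ _).resolve_left fun h' => h.apply_ne_self k (hinj ?_)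
    rw [h', hk]
    simp
  · rw [not_exists] at hex
    exact Or.inl fun k => (hτ k).resolve_right (hex k)

/-- The digraph whose arcs are those that occur in some run of a branching program. -/
def layeredModel {m : ℕ} (π : Fin m → Bool → Equiv.Perm (Fin 5))
    (hπ : ∀ l, IsTour ((π l false)⁻¹ * π l true)) :
    TourModel (Fin m) {y | IsTour (layeredMap fun l => π l (y l))} where
  V := Fin m × Fin 5
  fintype := inferInstance
  arc v w := ∃ b, w = (prevLayer v.1, π v.1 b v.2)
  tour y := layeredMap fun l => π l (y l)
  -- Any point would do in place of `0`: the two permutations of an instruction differ everywhere.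
  lit l := ((l.1, 0), (prevLayer l.1, π l.1 l.2 0))
  lit_injective := by
    have hne : ∀ l, π l false 0 ≠ π l true 0 := fun l h =>
      (hπ l).apply_ne_self 0 (by simp [← h])
    rintro ⟨l, b⟩ ⟨l', b'⟩ h
    simp only [Prod.mk.injEq, and_true] at h
    obtain ⟨rfl, -, h⟩ := h
    cases b <;> cases b'
    · rfl
    · exact absurd h (hne l)
    · exact absurd h.symm (hne l)
    · rfl
  isTour_tour _ hy := hy
  arc_tour y _ v := ⟨y v.1, rfl⟩
  eq_tour f hf harc := by
    have hinj := hf.injective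
    have hfst : ∀ l k, (f (l, k)).1 = prevLayer l := fun l k => by
      obtain ⟨b, hb⟩ := harc (l, k)
      rw [hb]
    have hcases : ∀ l, ∃ b, ∀ k, (f (l, k)).2 = π l b k := by
      intro l
      have := eq_or_eq_of_forall_eq_or_eq (hπ l) (τ := fun k => (f (l, k)).2)
        (fun k k' h => by
          have := hinj (Prod.ext ((hfst l k).trans (hfst l k').symm) h)
          exact (Prod.mk.inj this).2)
        (fun k => by
          obtain ⟨b, hb⟩ := harc (l, k)
          cases b <;> simp [hb])
      rcases this with h | h
      · exact ⟨false, h⟩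
      · exact ⟨true, h⟩
    choose y hy using hcases
    have hfy : f = layeredMap fun l => π l (y l) := by
      ext1 ⟨l, k⟩
      exact Prod.ext (hfst l k) (hy l k)
    exact ⟨y, by rw [Set.mem_ofPred_eq, ← hfy]; exact hf, hfy⟩
  affine v w := by
    obtain ⟨φ, hφ⟩ := exists_affine_of_coord v.1
      (fun b => if (prevLayer v.1, π v.1 b v.2) = w then 1 else 0)
    refine ⟨φ, fun y _ => ?_⟩
    rw [← hφ]
    simp only [layeredMap]
    congr
  lit_iff y _ l := by
    obtain ⟨l, b⟩ := l
    have hne : π l false 0 ≠ π l true 0 := fun h => (hπ l).apply_ne_self 0 (by simp [← h])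
    cases b <;> cases h : y l <;> simp [layeredMap, h, hne, hne.symm]

/-- Every nonempty set of vertices of a cube parametrizes the Hamiltonian cycles of a digraph. -/
theorem nonempty_tourModel {J : Type*} [Fintype J] [Nonempty J] (S : Set (J → Bool))
    (hS : S.Nonempty) : Nonempty (TourModel J S) := by
  classical
  obtain ⟨L, hvar, hL⟩ := exists_program S.toFinset (by simpa using hS)
  have hm : 0 < L.length := by
    obtain ⟨j⟩ := ‹Nonempty J›
    obtain ⟨i, hi, -⟩ := hvar j
    exact List.length_pos_of_mem hi
  let var : Fin L.length → J := fun l => (L.get l).var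
  have heval : ∀ x, (List.ofFn fun l => (L.get l).perm (x (var l))).prod =
      if x ∈ S then fiveCycle else 1 := by
    intro x
    have h1 : (List.ofFn fun l => (L.get l).perm (x (var l))) =
        L.map fun i => i.perm (x i.var) := by
      conv_rhs => rw [← List.ofFn_get L, List.map_ofFn]
      rfl
    rw [h1]
    simpa [evalProgram] using hL x
  have hsec : ∀ j, ∃ l, var l = j := by
    intro j
    obtain ⟨i, hi, hij⟩ := hvar j
    obtain ⟨l, rfl⟩ := List.get_of_mem hi
    exact ⟨l, hij⟩
  choose sec hsec using hsec
  -- All pairs of instructions reading the same variable are synchronized, so only bit vectors of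
  -- the form `x ∘ var` remain.
  obtain ⟨M⟩ := (layeredModel (fun l => (L.get l).perm)
    (fun l => (L.get l).isTour)).nonempty_syncAll
    (Finset.univ.filter fun p : Fin L.length × Fin L.length => var p.1 = var p.2)
  refine ⟨M.reindex var sec hsec fun y => ?_⟩
  simp only [Finset.mem_filter, Finset.mem_univ, true_and, Set.mem_ofPred_eq]
  constructor
  · rintro ⟨hy, hsync⟩
    have hyv : y = (y ∘ sec) ∘ var := funext fun l => hsync (l, sec (var l)) (hsec _).symm
    refine ⟨y ∘ sec, ?_, hyv⟩
    by_contra hx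
    have h1 := heval (y ∘ sec)
    rw [if_neg hx] at h1
    refine not_isTour_layeredMap hm h1 ?_
    rw [hyv] at hy
    exact hy
  · rintro ⟨x, hx, rfl⟩
    refine ⟨isTour_layeredMap hm ?_, fun p hp => by simp [hp]⟩
    have h1 := heval x
    rw [if_pos hx] at h1
    simp only [Function.comp_apply]
    rw [h1]
    exact isTour_fiveCycle

/-! ### From directed to undirected tours -/

section Subdivision

variable {V : Type*} {k : V → ℕ}

/-- The digraph in which every vertex `v` of a digraph is replaced by a directed path with `k v`
vertices. -/
def pathArc (R : V → V → Prop) (k : V → ℕ) (x y : Σ v, Fin (k v)) : Prop :=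
  (x.1 = y.1 ∧ x.2.val + 1 = y.2.val) ∨ (x.2.val + 1 = k x.1 ∧ y.2.val = 0 ∧ R x.1 y.1)

/-- The map induced on the digraph in which the vertices have been replaced by paths. -/
def pathMap (hk : ∀ v, 3 ≤ k v) (f : V → V) (x : Σ v, Fin (k v)) : Σ v, Fin (k v) :=
  if h : x.2.val + 1 < k x.1 then ⟨x.1, ⟨x.2.val + 1, h⟩⟩
  else ⟨f x.1, ⟨0, by have := hk (f x.1); omega⟩⟩

theorem sigma_fin_ext {x y : Σ v, Fin (k v)} (h : x.1 = y.1) (h' : x.2.val = y.2.val) :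
    x = y := by
  obtain ⟨v, i⟩ := x
  obtain ⟨w, j⟩ := y
  obtain rfl : v = w := h
  exact congrArg _ (Fin.ext h')

theorem pathArc_pathMap {R : V → V → Prop} (hk : ∀ v, 3 ≤ k v) {f : V → V}
    (hf : ∀ v, R v (f v)) (x : Σ v, Fin (k v)) : pathArc R k x (pathMap hk f x) := by
  unfold pathMap
  split_ifs with h
  · exact Or.inl ⟨rfl, rfl⟩
  · exact Or.inr ⟨by have := x.2.isLt; omega, rfl, hf _⟩

theorem mem_of_closed_of_zero_mem {hk : ∀ v, 3 ≤ k v} {f : V → V} {s : Set (Σ v, Fin (k v))}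
    (hs : ∀ x ∈ s, pathMap hk f x ∈ s) {v : V} {i : ℕ} (hi : i < k v)
    (hv : (⟨v, ⟨i, hi⟩⟩ : Σ v, Fin (k v)) ∈ s) (n : ℕ) :
    ∀ h : i + n < k v, (⟨v, ⟨i + n, h⟩⟩ : Σ v, Fin (k v)) ∈ s := by
  induction n with
  | zero => exact fun _ => hv
  | succ n ih =>
    intro h
    have := hs _ (ih (by omega))
    rwa [pathMap, dif_pos (by simpa [add_assoc] using h)] at this

theorem isTour_pathMap (hk : ∀ v, 3 ≤ k v) {f : V → V} (hf : IsTour f) :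
    IsTour (pathMap hk f) := by
  rintro s ⟨⟨v, i⟩, hx⟩ hcl
  have next : ∀ v i, (⟨v, i⟩ : Σ v, Fin (k v)) ∈ s →
      (⟨f v, ⟨0, by have := hk (f v); omega⟩⟩ : Σ v, Fin (k v)) ∈ s := by
    intro v i hv
    have := hcl _ (mem_of_closed_of_zero_mem hcl i.isLt hv (k v - 1 - i) (by omega))
    rwa [pathMap, dif_neg (by simp; omega)] at this
  have hall : ∀ v, (⟨v, ⟨0, by have := hk v; omega⟩⟩ : Σ v, Fin (k v)) ∈ s :=
    hf.forall_of_closed (p := fun v => (⟨v, ⟨0, by have := hk v; omega⟩⟩ : Σ v, Fin (k v)) ∈ s)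
      (next v i hx) (fun w hw => next w _ hw)
  refine Set.eq_univ_of_forall fun ⟨w, j⟩ => ?_
  have := mem_of_closed_of_zero_mem hcl _ (hall w) j (by simp)
  simpa using this

theorem exists_eq_pathMap {R : V → V → Prop} (hk : ∀ v, 3 ≤ k v)
    {g : (Σ v, Fin (k v)) → Σ v, Fin (k v)} (hg : IsTour g) (harc : ∀ x, pathArc R k x (g x)) :
    ∃ f, IsTour f ∧ (∀ v, R v (f v)) ∧ g = pathMap hk f := by
  let last : ∀ v, Σ v, Fin (k v) := fun v => ⟨v, ⟨k v - 1, by have := hk v; omega⟩⟩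
  have hlast : ∀ v, (g (last v)).2.val = 0 ∧ R v (g (last v)).1 := by
    intro v
    rcases harc (last v) with ⟨h1, h2⟩ | ⟨-, h⟩
    · have h3 := (g (last v)).2.isLt
      have h4 := hk v
      rw [← h2, ← h1] at h3
      simp only [last] at h3
      omega
    · exact h
  have hgf : g = pathMap hk (fun v => (g (last v)).1) := by
    ext1 x
    unfold pathMap
    split_ifs with h
    · rcases harc x with ⟨h1, h2⟩ | ⟨h1, -⟩
      · exact sigma_fin_ext h1.symm h2.symm
      · omega
    · have hx : x = last x.1 := sigma_fin_ext rfl (by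
        have := x.2.isLt
        simp only [last]
        omega)
      rw [hx]
      exact sigma_fin_ext rfl (hlast _).1
  refine ⟨fun v => (g (last v)).1, ?_, fun v => (hlast v).2, hgf⟩
  rintro s ⟨v, hv⟩ hcl
  refine Set.eq_univ_of_forall fun w => ?_
  refine hg.forall_of_closed (p := fun x => x.1 ∈ s) (x := last v) hv ?_ (last w)
  intro x hx
  rw [hgf, pathMap]
  split_ifs
  · exact hx
  · exact hcl _ hx

/-- Forward travel cannot turn backward. After an inner step the only arc into `g x` comes from `x`,
and returning there is excluded. After a jump, a reversal would leave the first vertex of a path at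
once, and the second vertex would have just the third one as a possible neighbour in the tour. Hence
the requirement of three vertices per path. -/
theorem pathArc_of_pathArc {R : V → V → Prop} (hk : ∀ v, 3 ≤ k v)
    {g : (Σ v, Fin (k v)) → Σ v, Fin (k v)} (hinj : Function.Injective g)
    (hsurj : Function.Surjective g) (hg : ∀ x, g (g x) ≠ x)
    (harc : ∀ x, pathArc R k x (g x) ∨ pathArc R k (g x) x) {x : Σ v, Fin (k v)}
    (hx : pathArc R k x (g x)) : pathArc R k (g x) (g (g x)) := by
  rcases harc (g x) with h | h
  · exact h
  exfalso
  rcases hx with ⟨h1, h2⟩ | ⟨h1, h2, -⟩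
  · rcases h with ⟨h3, h4⟩ | ⟨h3, h4, -⟩
    · exact hg x (sigma_fin_ext (h3.trans h1.symm) (by omega))
    · omega
  · rcases h with ⟨h3, h4⟩ | ⟨h3, h4, -⟩
    · omega
    · -- the second vertex of the path starting at `g x` has no way to be visited
      have hw := hk (g x).1
      obtain ⟨z, hz⟩ := hsurj ⟨(g x).1, ⟨1, by omega⟩⟩
      have hnext := harc (g z)
      have hprev := harc z
      rw [hz] at hnext hprev
      have hnbr : ∀ y : Σ v, Fin (k v), pathArc R k ⟨(g x).1, ⟨1, by omega⟩⟩ y ∨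
          pathArc R k y ⟨(g x).1, ⟨1, by omega⟩⟩ →
          y = g x ∨ y = ⟨(g x).1, ⟨2, by omega⟩⟩ := by
        rintro y ((⟨h5, h6⟩ | ⟨h5, -⟩) | (⟨h5, h6⟩ | ⟨-, h5, -⟩))
        · exact Or.inr (sigma_fin_ext h5.symm h6.symm)
        · simp only at h5; omega
        · exact Or.inl (sigma_fin_ext h5 (by simp only at h6; omega))
        · simp at h5
      have hz1 : z ≠ g x := by
        rintro rfl
        rw [hz] at h3
        simp only at h3
        omega
      have hz2 : g (g z) ≠ g x := by
        intro h5
        have h6 := hinj h5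
        rw [hz] at h6
        rw [← h6] at h1
        simp only at h1
        omega
      rw [hz] at hz2
      have h7 := (hnbr z hprev.symm).resolve_left hz1
      have h8 := (hnbr _ hnext).resolve_left hz2
      exact hg z (by rw [hz, h8, h7])

/-- The second vertex of a path has only one incoming arc, so either `g` or its inverse leaves it
forward; that orientation then persists along the whole tour. Both have the same undirected edges.
-/
theorem exists_pathArc_or {R : V → V → Prop} (hk : ∀ v, 3 ≤ k v)
    {g : (Σ v, Fin (k v)) → Σ v, Fin (k v)} (hg : IsTour g) (hinj : Function.Injective g)
    (hne : ∀ x, g (g x) ≠ x) (harc : ∀ x, pathArc R k x (g x) ∨ pathArc R k (g x) x) (v₀ : V) :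
    ∃ g', IsTour g' ∧ (∀ x, pathArc R k x (g' x)) ∧ ∀ x y, (g' x = y ∨ g' y = x) ↔
      (g x = y ∨ g y = x) := by
  have hw := hk v₀
  let x₀ : Σ v, Fin (k v) := ⟨v₀, ⟨1, by omega⟩⟩
  rcases harc x₀ with h | h
  · exact ⟨g, hg, hg.forall_of_closed h fun x hx =>
      pathArc_of_pathArc hk hinj hg.surjective hne harc hx, fun _ _ => Iff.rfl⟩
  · let e := Equiv.ofBijective g ⟨hinj, hg.surjective⟩
    have he : ∀ x, g (e.symm x) = x := e.apply_symm_apply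
    have he' : ∀ x, e.symm (g x) = x := e.symm_apply_apply
    have htour : IsTour e.symm := hg.of_leftInverse he'
    have harc' : ∀ x, pathArc R k x (e.symm x) ∨ pathArc R k (e.symm x) x := by
      intro x
      have := harc (e.symm x)
      rw [he] at this
      exact this.symm
    have hne' : ∀ x, e.symm (e.symm x) ≠ x := by
      intro x h
      apply hne x
      nth_rewrite 1 [← h]
      rw [he, he]
    have h0 : pathArc R k x₀ (e.symm x₀) := by
      refine (harc' x₀).resolve_right fun h' => ?_
      have aux : ∀ y : Σ v, Fin (k v), pathArc R k y x₀ → y = ⟨v₀, ⟨0, by omega⟩⟩ := by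
        rintro y (⟨h1, h2⟩ | ⟨-, h2, -⟩)
        · exact sigma_fin_ext h1 (by simp only [x₀] at h2 ⊢; omega)
        · simp [x₀] at h2
      have := (aux _ h).trans (aux _ h').symm
      exact hne x₀ (by rw [this, he])
    refine ⟨e.symm, htour, htour.forall_of_closed h0 fun x hx =>
      pathArc_of_pathArc hk e.symm.injective e.symm.surjective hne' harc' hx, fun x y => ?_⟩
    have h1 : ∀ x y, e.symm x = y ↔ g y = x := fun x y =>
      ⟨fun h => by rw [← h, he], fun h => by rw [← h, he']⟩
    rw [h1, h1]
    exact or_comm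

end Subdivision

open Classical in
/-- The adjacency matrix of the undirected cycle underlying a tour. -/
noncomputable def tourMatrix {W : Type*} (f : W → W) : Matrix W W ℝ :=
  fun x y => if f x = y ∨ f y = x then 1 else 0

/-- With at least three vertices a tour contains no 2-cycle, so the symmetric adjacency entry is the
sum of the two directed indicators, each of which is affine in the parameter. -/
theorem exists_affine_tourMatrix_sigma {J : Type*} {S : Set (J → Bool)} (M : TourModel J S)
    (k : M.V → ℕ) (hk : ∀ v, 3 ≤ k v) (v₀ : M.V) :
    ∃ (G : (Σ v, Fin (k v)) → (Σ v, Fin (k v)) → Prop)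
      (T : (J → ℝ) →ᵃ[ℝ] Matrix (Σ v, Fin (k v)) (Σ v, Fin (k v)) ℝ),
      (∀ x ∈ S, ∃ f, IsTour f ∧ (∀ v, G v (f v) ∧ G (f v) v) ∧
        T (cubeVertex x) = tourMatrix f) ∧
      (∀ f, IsTour f → (∀ v, G v (f v)) → ∃ x ∈ S, tourMatrix f = T (cubeVertex x)) ∧
      ∀ j, ∃ v w, ∀ x ∈ S, T (cubeVertex x) v w = cubeVertex x j := by
  classical
  have := M.fintype
  have hcard : 3 ≤ Nat.card (Σ v, Fin (k v)) := by
    rw [Nat.card_eq_fintype_card, Fintype.card_sigma]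
    calc 3 ≤ Fintype.card (Fin (k v₀)) := by simpa using hk v₀
      _ ≤ _ := Finset.single_le_sum (f := fun v => Fintype.card (Fin (k v)))
        (fun _ _ => Nat.zero_le _) (Finset.mem_univ v₀)
  have hdir : ∀ a b, ∃ φ : (J → ℝ) →ᵃ[ℝ] ℝ, ∀ x ∈ S,
      (if pathMap hk (M.tour x) a = b then 1 else 0) = φ (cubeVertex x) := by
    intro a b
    by_cases h : a.2.val + 1 < k a.1
    · refine ⟨AffineMap.const ℝ _ (if (⟨a.1, ⟨a.2.val + 1, h⟩⟩ : Σ v, Fin (k v)) = b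
        then 1 else 0), fun x _ => ?_⟩
      simp [pathMap, h]
    · by_cases hb : b.2.val = 0
      · obtain ⟨φ, hφ⟩ := M.affine a.1 b.1
        refine ⟨φ, fun x hx => ?_⟩
        rw [← hφ x hx]
        congr 1
        rw [pathMap, dif_neg h, eq_iff_iff]
        exact ⟨fun h' => by rw [← h'], fun h' => sigma_fin_ext h' hb.symm⟩
      · refine ⟨0, fun x _ => ?_⟩
        rw [pathMap, dif_neg h, if_neg]
        · rfl
        · rintro rfl
          exact hb rfl
  choose φ hφ using hdir
  have hT : ∀ x ∈ S, ∀ a b, tourMatrix (pathMap hk (M.tour x)) a b =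
      φ a b (cubeVertex x) + φ b a (cubeVertex x) := by
    intro x hx a b
    rw [← hφ a b x hx, ← hφ b a x hx, tourMatrix]
    have hne := (isTour_pathMap hk (M.isTour_tour x hx)).apply_apply_ne_self hcard a
    by_cases h1 : pathMap hk (M.tour x) a = b
    · have h2 : pathMap hk (M.tour x) b ≠ a := h1 ▸ hne
      simp [h1, h2]
    · simp [h1]
  let T : (J → ℝ) →ᵃ[ℝ] Matrix (Σ v, Fin (k v)) (Σ v, Fin (k v)) ℝ :=
    AffineMap.pi fun a => AffineMap.pi fun b => φ a b + φ b a
  have hT' : ∀ x ∈ S, T (cubeVertex x) = tourMatrix (pathMap hk (M.tour x)) := by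
    intro x hx
    ext a b
    rw [hT x hx]
    rfl
  refine ⟨fun a b => pathArc M.arc k a b ∨ pathArc M.arc k b a, T, fun x hx => ?_,
    fun f hf harc => ?_, fun j => ?_⟩
  · have := pathArc_pathMap hk (M.arc_tour x hx)
    exact ⟨_, isTour_pathMap hk (M.isTour_tour x hx), fun v => ⟨Or.inl (this v),
      Or.inr (this v)⟩, hT' x hx⟩
  · obtain ⟨g, hg, hgarc, hgf⟩ := exists_pathArc_or hk hf hf.injective
      (hf.apply_apply_ne_self hcard) harc v₀
    obtain ⟨h, hh, hharc, rfl⟩ := exists_eq_pathMap hk hg hgarc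
    obtain ⟨x, hx, rfl⟩ := M.eq_tour h hh hharc
    refine ⟨x, hx, ?_⟩
    rw [hT' x hx]
    ext a b
    simp only [tourMatrix, hgf]
    congr
  · have h3 := hk (M.lit (j, true)).1
    have h3' := hk (M.lit (j, true)).2
    -- The edge from the end of the tail's path to the start of the head's path records bit `j`. It
    -- cannot be used backwards: the successor of a first vertex has index 1, which is not a last
    -- index.
    refine ⟨⟨(M.lit (j, true)).1, ⟨k (M.lit (j, true)).1 - 1, by omega⟩⟩,
      ⟨(M.lit (j, true)).2, ⟨0, by omega⟩⟩, fun x hx => ?_⟩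
    have hiff := M.lit_iff x hx (j, true)
    rw [hT' x hx, tourMatrix, cubeVertex]
    congr 1
    rw [eq_iff_iff, ← hiff, pathMap, pathMap, dif_neg (by simp only; omega),
      dif_pos (by simp only; omega)]
    constructor
    · rintro (h | h)
      · exact congrArg Sigma.fst h
      · exfalso
        have h1 : (M.lit (j, true)).2 = (M.lit (j, true)).1 := congrArg Sigma.fst h
        have h2 := congrArg (fun z : Σ v, Fin (k v) => z.2.val) h
        simp only at h2
        omega
    · exact fun h => Or.inl (sigma_fin_ext h rfl)

/-- For large `n`, every nonempty set of vertices of a cube is affinely equivalent to the set of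
all tours through the vertices of a suitable graph with `n` vertices. -/
theorem exists_affine_tourMatrix {J : Type*} [Fintype J] [Nonempty J] {S : Set (J → Bool)}
    (hS : S.Nonempty) : ∃ N, 3 ≤ N ∧ ∀ n, N ≤ n → ∃ (G : Fin n → Fin n → Prop)
      (T : (J → ℝ) →ᵃ[ℝ] Matrix (Fin n) (Fin n) ℝ),
      (∀ x ∈ S, ∃ f, IsTour f ∧ (∀ v, G v (f v) ∧ G (f v) v) ∧
        T (cubeVertex x) = tourMatrix f) ∧
      (∀ f, IsTour f → (∀ v, G v (f v)) → ∃ x ∈ S, tourMatrix f = T (cubeVertex x)) ∧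
      ∀ j, ∃ v w, ∀ x ∈ S, T (cubeVertex x) v w = cubeVertex x j := by
  classical
  obtain ⟨M⟩ := nonempty_tourModel S hS
  have := M.fintype
  obtain ⟨j₀⟩ := ‹Nonempty J›
  let v₀ := (M.lit (j₀, true)).1
  have hpos : 0 < Fintype.card M.V := Fintype.card_pos_iff.mpr ⟨v₀⟩
  refine ⟨3 * Fintype.card M.V, by omega, fun n hn => ?_⟩
  -- The path of `v₀` absorbs all surplus vertices, which makes the total exactly `n`.
  let k : M.V → ℕ := fun v => if v = v₀ then n - 3 * (Fintype.card M.V - 1) else 3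
  have hk : ∀ v, 3 ≤ k v := by
    intro v
    simp only [k]
    split_ifs <;> omega
  have hcard : Fintype.card (Σ v, Fin (k v)) = n := by
    rw [Fintype.card_sigma]
    simp only [Fintype.card_fin, k]
    rw [← Finset.add_sum_erase _ _ (Finset.mem_univ v₀), if_pos rfl,
      Finset.sum_congr rfl (g := fun _ => 3) (fun v hv => if_neg (Finset.ne_of_mem_erase hv)),
      Finset.sum_const, Finset.card_erase_of_mem (Finset.mem_univ _), Finset.card_univ]
    simp only [smul_eq_mul]
    omega
  let e : (Σ v, Fin (k v)) ≃ Fin n := Fintype.equivFinOfCardEq hcard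
  obtain ⟨G, T, h1, h2, h3⟩ := exists_affine_tourMatrix_sigma M k hk v₀
  have hmat : ∀ f : (Σ v, Fin (k v)) → Σ v, Fin (k v),
      Matrix.reindexLinearEquiv ℝ ℝ e e (tourMatrix f) =
        tourMatrix fun y => e (f (e.symm y)) := by
    intro f
    ext a b
    simp only [Matrix.coe_reindexLinearEquiv, Matrix.reindex_apply, Matrix.submatrix_apply,
      tourMatrix, ← Equiv.eq_symm_apply]
    congr
  refine ⟨fun a b => G (e.symm a) (e.symm b),
    (Matrix.reindexLinearEquiv ℝ ℝ e e).toLinearMap.toAffineMap.comp T, fun x hx => ?_,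
    fun f hf harc => ?_, fun j => ?_⟩
  · obtain ⟨f, hf, hG, hT⟩ := h1 x hx
    refine ⟨fun y => e (f (e.symm y)), (IsTour.conj_iff e).mpr hf, fun v => ?_, ?_⟩
    · simpa using hG (e.symm v)
    · rw [← hmat, ← hT]
      rfl
  · obtain ⟨x, hx, hT⟩ := h2 (fun y => e.symm (f (e y))) ((IsTour.conj_iff e.symm).mpr hf)
      (fun v => by simpa using harc (e v))
    refine ⟨x, hx, ?_⟩
    have := hmat fun y => e.symm (f (e y))
    rw [hT] at this
    simp only [Equiv.apply_symm_apply] at this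
    exact this.symm
  · obtain ⟨v, w, h⟩ := h3 j
    refine ⟨e v, e w, fun x hx => ?_⟩
    rw [← h x hx]
    simp

/-! ### Tours and Hamiltonian cycles -/

namespace IsTour

variable {V : Type*} {f : V → V}

theorem minimalPeriod_pos (hf : IsTour f) (x : V) : 0 < Function.minimalPeriod f x := by
  obtain ⟨k, hk⟩ := hf.exists_iterate (f x) x
  exact Function.IsPeriodicPt.minimalPeriod_pos (n := k + 1) (Nat.succ_pos k) hk

theorem exists_iterate_lt (hf : IsTour f) (x y : V) :
    ∃ k < Function.minimalPeriod f x, f^[k] x = y := by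
  obtain ⟨k, rfl⟩ := hf.exists_iterate x y
  exact ⟨k % Function.minimalPeriod f x, Nat.mod_lt _ (hf.minimalPeriod_pos x),
    Function.iterate_mod_minimalPeriod_eq⟩

theorem minimalPeriod_eq_card (hf : IsTour f) (x : V) :
    Function.minimalPeriod f x = Nat.card V := by
  let φ : Fin (Function.minimalPeriod f x) → V := fun k => f^[k] x
  have hφ : Function.Bijective φ := by
    constructor
    · intro i j hij
      exact Fin.ext (Function.iterate_injOn_Iio_minimalPeriod i.isLt j.isLt hij)
    · intro y
      obtain ⟨k, hk, h⟩ := hf.exists_iterate_lt x y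
      exact ⟨⟨k, hk⟩, h⟩
  simpa using Nat.card_eq_of_bijective φ hφ

end IsTour

/-- The walk `v, f v, f (f v), …` with `k` steps. -/
def iterateWalk {V : Type*} {G : SimpleGraph V} {f : V → V} (hf : ∀ v, G.Adj v (f v)) :
    ∀ (k : ℕ) (v : V), G.Walk v (f^[k] v)
  | 0, _ => .nil
  | k + 1, v => .cons (hf v) (iterateWalk hf k (f v))

theorem length_iterateWalk {V : Type*} {G : SimpleGraph V} {f : V → V}
    (hf : ∀ v, G.Adj v (f v)) (k : ℕ) (v : V) : (iterateWalk hf k v).length = k := by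
  induction k generalizing v with
  | zero => rfl
  | succ k ih => exact congrArg (· + 1) (ih (f v))

theorem getVert_iterateWalk {V : Type*} {G : SimpleGraph V} {f : V → V}
    (hf : ∀ v, G.Adj v (f v)) (k : ℕ) (v : V) {i : ℕ} (hi : i ≤ k) :
    (iterateWalk hf k v).getVert i = f^[i] v := by
  induction k generalizing v i with
  | zero =>
    obtain rfl : i = 0 := by omega
    exact SimpleGraph.Walk.getVert_zero _
  | succ k ih =>
    cases i with
    | zero => exact SimpleGraph.Walk.getVert_zero _
    | succ i => exact ih (f v) (by omega)

theorem tourMatrix_mem_tourMatrices {n : ℕ} (hn : 3 ≤ n) {f : Fin n → Fin n} (hf : IsTour f) :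
    tourMatrix f ∈ tourMatrices n := by
  classical
  have : Nontrivial (Fin n) := Fin.nontrivial_iff_two_le.mpr (by omega)
  have hadj : ∀ v, (⊤ : SimpleGraph (Fin n)).Adj v (f v) := fun v =>
    (SimpleGraph.top_adj _ _).mpr (hf.apply_ne_self v).symm
  let v₀ : Fin n := ⟨0, by omega⟩
  have hper : Function.minimalPeriod f v₀ = n := by simpa using hf.minimalPeriod_eq_card v₀
  have hclose : f^[n] v₀ = v₀ := by
    have := Function.isPeriodicPt_minimalPeriod f v₀
    rwa [hper] at this
  let p : (⊤ : SimpleGraph (Fin n)).Walk v₀ v₀ := (iterateWalk hadj n v₀).copy rfl hclose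
  have hlen : p.length = n := by simp [p, length_iterateWalk]
  have hget : ∀ i ≤ n, p.getVert i = f^[i] v₀ := fun i hi => by
    simp [p, getVert_iterateWalk hadj n v₀ hi]
  have hinj : ∀ i < n, ∀ j < n, f^[i] v₀ = f^[j] v₀ → i = j := fun i hi j hj h =>
    Function.iterate_injOn_Iio_minimalPeriod (hper.symm ▸ hi) (hper.symm ▸ hj) h
  have hnil : ¬ p.Nil := by
    rw [← SimpleGraph.Walk.length_eq_zero_iff, hlen]
    omega
  have htail : p.tail.length + 1 = n := by
    rw [SimpleGraph.Walk.length_tail_add_one hnil, hlen]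
  have hcycle : p.IsCycle := by
    refine SimpleGraph.Walk.isCycle_iff_isPath_tail_and_le_length.mpr ⟨?_, by omega⟩
    rw [← SimpleGraph.Walk.IsPath.getVert_injOn_iff]
    intro i hi j hj hij
    rw [Set.mem_ofPred_eq] at hi hj
    rw [SimpleGraph.Walk.getVert_tail, SimpleGraph.Walk.getVert_tail, hget _ (by omega),
      hget _ (by omega), Function.iterate_succ_apply', Function.iterate_succ_apply'] at hij
    exact hinj i (by omega) j (by omega) (hf.injective hij)
  refine ⟨v₀, p, ?_, ?_⟩
  · exact SimpleGraph.Walk.isHamiltonianCycle_iff_isCycle_and_length_eq.mpr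
      ⟨hcycle, by simpa using hlen⟩
  · ext a b
    rw [SimpleGraph.adjMatrix_apply, tourMatrix]
    congr 1
    rw [SimpleGraph.Subgraph.spanningCoe_adj, SimpleGraph.Walk.toSubgraph_adj_iff, eq_iff_iff,
      hlen]
    constructor
    · have key : ∀ a b, f a = b → ∃ i, s(p.getVert i, p.getVert (i + 1)) = s(a, b) ∧ i < n := by
        rintro a b rfl
        obtain ⟨i, hi, rfl⟩ := hf.exists_iterate_lt v₀ a
        rw [hper] at hi
        refine ⟨i, ?_, hi⟩
        rw [hget _ hi.le, hget _ hi, Function.iterate_succ_apply']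
      rintro (h | h)
      · exact key a b h
      · rw [Sym2.eq_swap]
        exact key b a h
    · rintro ⟨i, h, hi⟩
      rw [hget _ hi.le, hget _ hi, Function.iterate_succ_apply', Sym2.eq_iff] at h
      rcases h with ⟨rfl, rfl⟩ | ⟨rfl, rfl⟩ <;> simp

theorem exists_eq_tourMatrix {n : ℕ} {A : Matrix (Fin n) (Fin n) ℝ} (hA : A ∈ tourMatrices n) :
    ∃ f, IsTour f ∧ A = tourMatrix f := by
  classical
  obtain ⟨v, p, hp, rfl⟩ := hA
  have hlen : p.length = n := by simpa using hp.length_eq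
  have hn : 0 < n := by have := hp.isCycle.three_le_length; omega
  have hinj := hp.isCycle.getVert_injOn'
  have hidx : ∀ x, ∃ i < n, p.getVert i = x := by
    intro x
    obtain ⟨i, hi, hin⟩ := SimpleGraph.Walk.mem_support_iff_exists_getVert.mp (hp.mem_support x)
    rcases hin.lt_or_eq with h | h
    · exact ⟨i, hlen ▸ h, hi⟩
    -- The final vertex of the closed walk is also its vertex of index 0.
    · refine ⟨0, hn, ?_⟩
      rw [← hi, h]
      simp
  choose idx hidx hget using hidx
  have hidx' : ∀ i < n, idx (p.getVert i) = i := fun i hi =>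
    hinj (by have := hidx (p.getVert i); rw [Set.mem_ofPred_eq]; omega)
      (by rw [Set.mem_ofPred_eq]; omega) (hget _)
  let f : Fin n → Fin n := fun x => p.getVert (idx x + 1)
  have hf : ∀ i < n, f (p.getVert i) = p.getVert (i + 1) := fun i hi => by
    simp only [f, hidx' i hi]
  refine ⟨f, ?_, ?_⟩
  · rintro s ⟨x, hx⟩ hcl
    have step : ∀ i k, i + k ≤ n → p.getVert i ∈ s → p.getVert (i + k) ∈ s := by
      intro i k
      induction k with
      | zero => exact fun _ h => h
      | succ k ih =>
        intro hk hi
        rw [← add_assoc, ← hf _ (by omega)]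
        exact hcl _ (ih (by omega) hi)
    have hzero : p.getVert 0 ∈ s := by
      have := step (idx x) (n - idx x) (by have := hidx x; omega) (by rwa [hget])
      rw [show idx x + (n - idx x) = p.length by have := hidx x; omega] at this
      simpa using this
    refine Set.eq_univ_of_forall fun y => ?_
    have := step 0 (idx y) (by have := hidx y; omega) hzero
    rwa [zero_add, hget] at this
  · ext a b
    rw [SimpleGraph.adjMatrix_apply, tourMatrix]
    congr 1
    rw [SimpleGraph.Subgraph.spanningCoe_adj, SimpleGraph.Walk.toSubgraph_adj_iff, eq_iff_iff,
      hlen]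
    constructor
    · rintro ⟨i, h, hi⟩
      rw [Sym2.eq_iff, ← hf i hi] at h
      rcases h with ⟨rfl, rfl⟩ | ⟨rfl, rfl⟩ <;> simp
    · rintro (rfl | rfl)
      · exact ⟨idx a, by rw [← hf _ (hidx a), hget], hidx a⟩
      · exact ⟨idx b, by rw [← hf _ (hidx b), hget, Sym2.eq_swap], hidx b⟩

/-- For large `n`, every nonempty set of vertices of a cube is affinely equivalent to the set of
all tour matrices with support in a suitable set of edges. -/
theorem exists_affine_image_eq {J : Type*} [Fintype J] [Nonempty J] {S : Set (J → Bool)}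
    (hS : S.Nonempty) : ∃ N, 3 ≤ N ∧ ∀ n, N ≤ n → ∃ (G : Fin n → Fin n → Prop)
      (T : (J → ℝ) →ᵃ[ℝ] Matrix (Fin n) (Fin n) ℝ),
      T '' (cubeVertex '' S) = {A ∈ tourMatrices n | ∀ v w, ¬ G v w → A v w = 0} ∧
      ∀ j, ∃ v w, ∀ x ∈ S, T (cubeVertex x) v w = cubeVertex x j := by
  obtain ⟨N, hN, h⟩ := exists_affine_tourMatrix hS
  refine ⟨N, hN, fun n hn => ?_⟩
  obtain ⟨G, T, h1, h2, h3⟩ := h n hn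
  refine ⟨G, T, Set.Subset.antisymm ?_ ?_, h3⟩
  · rintro _ ⟨_, ⟨x, hx, rfl⟩, rfl⟩
    obtain ⟨f, hf, hG, hT⟩ := h1 x hx
    rw [hT]
    refine ⟨tourMatrix_mem_tourMatrices (hN.trans hn) hf, fun v w hvw => if_neg ?_⟩
    rintro (rfl | rfl)
    · exact hvw (hG v).1
    · exact hvw (hG w).2
  · rintro A ⟨hA, hG⟩
    obtain ⟨f, hf, rfl⟩ := exists_eq_tourMatrix hA
    obtain ⟨x, hx, hT⟩ := h2 f hf fun v => by
      by_contra hv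
      have := hG v (f v) hv
      simp [tourMatrix] at this
    exact ⟨_, ⟨x, hx, rfl⟩, hT.symm⟩

/-! ### Faces of convex hulls -/

section Faces

variable {E W : Type*} [AddCommGroup E] [Module ℝ E] [AddCommGroup W] [Module ℝ W]

/-- The points with both properties form a convex set containing `A`: a convex combination of
nonnegative numbers vanishes only if every term does. -/
theorem nonneg_and_mem_of_mem_convexHull {A : Set E} {h : E →ᵃ[ℝ] ℝ} (hA : ∀ a ∈ A, 0 ≤ h a)
    {x : E} (hx : x ∈ convexHull ℝ A) :
    0 ≤ h x ∧ (h x = 0 → x ∈ convexHull ℝ {a ∈ A | h a = 0}) := by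
  revert x
  change convexHull ℝ A ⊆ {x | 0 ≤ h x ∧ (h x = 0 → x ∈ convexHull ℝ {a ∈ A | h a = 0})}
  refine convexHull_min (fun a ha => ⟨hA a ha, fun h0 => subset_convexHull ℝ _ ⟨ha, h0⟩⟩) ?_
  rintro x ⟨hx, hx'⟩ y ⟨hy, hy'⟩ a b ha hb hab
  have hcombo : h (a • x + b • y) = a * h x + b * h y := Convex.combo_affine_apply hab
  refine ⟨by rw [hcombo]; positivity, fun h0 => ?_⟩
  rw [hcombo] at h0
  have h1 : a * h x = 0 := by nlinarith [mul_nonneg ha hx, mul_nonneg hb hy]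
  have h2 : b * h y = 0 := by nlinarith [mul_nonneg ha hx, mul_nonneg hb hy]
  rcases mul_eq_zero.mp h1 with rfl | h1
  · obtain rfl : b = 1 := by linarith
    simpa using hy' (by simpa using h2)
  rcases mul_eq_zero.mp h2 with rfl | h2
  · obtain rfl : a = 1 := by linarith
    simpa using hx' (by simpa using h1)
  exact convex_convexHull ℝ _ (hx' h1) (hy' h2) ha hb hab

theorem eq_zero_of_mem_convexHull {A : Set E} {h : E →ᵃ[ℝ] ℝ} {x : E}
    (hx : x ∈ convexHull ℝ {a ∈ A | h a = 0}) : h x = 0 := by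
  have hconv : Convex ℝ {x | h x = 0} := by
    intro x hx y hy a b _ _ hab
    rw [Set.mem_ofPred_eq] at hx hy ⊢
    rw [Convex.combo_affine_apply hab, hx, hy]
    simp
  exact convexHull_min (fun a ha => ha.2) hconv hx

/-- The points at which a valid inequality is tight generate a face. -/
theorem isFaceOf_convexHull {A : Set E} {h : E →ᵃ[ℝ] ℝ} (hA : ∀ a ∈ A, 0 ≤ h a) :
    IsFaceOf (convexHull ℝ A) (convexHull ℝ {a ∈ A | h a = 0}) := by
  refine ⟨convex_convexHull ℝ _, convexHull_mono fun a ha => ha.1, ?_⟩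
  rintro x hx y hy z hz ⟨a, b, ha, hb, hab, rfl⟩
  have hz' := eq_zero_of_mem_convexHull hz
  rw [Convex.combo_affine_apply hab, smul_eq_mul, smul_eq_mul] at hz'
  have h1 := nonneg_and_mem_of_mem_convexHull hA hx
  have h2 := (nonneg_and_mem_of_mem_convexHull hA hy).1
  refine h1.2 ?_
  have h3 : a * h x = 0 := by nlinarith [mul_nonneg ha.le h1.1, mul_nonneg hb.le h2]
  exact (mul_eq_zero.mp h3).resolve_left ha.ne'

theorem AffinelyIsomorphic.image {V : Type*} [AddCommGroup V] [Module ℝ V] {P : Set V}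
    {F : Set E} (h : AffinelyIsomorphic P F) {ψ : E →ᵃ[ℝ] W} (hψ : Function.Injective ψ) :
    AffinelyIsomorphic P (ψ '' F) := by
  obtain ⟨f, hf⟩ := h
  exact ⟨ψ.comp f, (hψ.injOn.bijOn_image).comp hf⟩

/-- If a generating set of a convex set is mapped to nonnegative numbers by an affine function,
and the zeros of that function among the generators form an affine copy of a convex set `F`, then
this copy is a face. -/
theorem exists_face_of_image_eq {V : Type*} [AddCommGroup V] [Module ℝ V] {P : Set V} {F : Set E}
    (hP : AffinelyIsomorphic P F) (hF : Convex ℝ F) {A : Set W} {H : W →ᵃ[ℝ] ℝ}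
    (hA : ∀ a ∈ A, 0 ≤ H a) {ψ : E →ᵃ[ℝ] W} (hψ : Function.Injective ψ)
    (hz : {a ∈ A | H a = 0} = ψ '' F) :
    ∃ F', IsFaceOf (convexHull ℝ A) F' ∧ AffinelyIsomorphic P F' := by
  refine ⟨_, isFaceOf_convexHull hA, ?_⟩
  rw [hz, (hF.affine_image ψ).convexHull_eq]
  exact hP.image hψ

/-! ### Faces of tensor products and symmetric powers -/

theorem exists_face_convexTensor {V : Type*} [AddCommGroup V] [Module ℝ V] {P : Set V}
    {K F : Set E} {L : Set W} (hP : AffinelyIsomorphic P F) (hF : Convex ℝ F) {h : E →ᵃ[ℝ] ℝ}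
    (hh : ∀ p ∈ K, 0 ≤ h p) (hFK : ∀ p, p ∈ F ↔ p ∈ K ∧ h p = 0) {g : W →ᵃ[ℝ] ℝ}
    (hg : ∀ p ∈ L, 0 ≤ g p) {q : W} (hq : ∀ p, p = q ↔ p ∈ L ∧ g p = 0) :
    ∃ F', IsFaceOf (convexTensor K L) F' ∧ AffinelyIsomorphic P F' := by
  let ψ : E →ᵃ[ℝ] E × W × (E ⊗[ℝ] W) :=
    (LinearMap.id.prod ((0 : E →ₗ[ℝ] W).prod ((TensorProduct.mk ℝ E W).flip q))).toAffineMap +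
      AffineMap.const ℝ E (0, q, 0)
  have hψ : ∀ p, ψ p = (p, q, p ⊗ₜ[ℝ] q) := fun p => by simp [ψ]
  let H : E × W × (E ⊗[ℝ] W) →ᵃ[ℝ] ℝ :=
    h.comp (LinearMap.fst ℝ _ _).toAffineMap +
      g.comp ((LinearMap.fst ℝ _ _).comp (LinearMap.snd ℝ _ _)).toAffineMap
  have hH : ∀ a b c, H (a, b, c) = h a + g b := fun a b c => by simp [H]
  refine exists_face_of_image_eq hP hF (H := H) (ψ := ψ) ?_ ?_ ?_
  · rintro _ ⟨p, hp, r, hr, rfl⟩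
    rw [hH]
    exact add_nonneg (hh p hp) (hg r hr)
  · intro p p' hpp
    rw [hψ, hψ] at hpp
    exact (Prod.mk.inj hpp).1
  · ext a
    constructor
    · rintro ⟨⟨p, hp, r, hr, rfl⟩, h0⟩
      rw [hH] at h0
      have h1 := hh p hp
      have h2 := hg r hr
      obtain rfl := (hq r).mpr ⟨hr, by linarith⟩
      exact ⟨p, (hFK p).mpr ⟨hp, by linarith⟩, hψ p⟩
    · rintro ⟨p, hp, rfl⟩
      obtain ⟨h1, h2⟩ := (hFK p).mp hp
      obtain ⟨h3, h4⟩ := (hq q).mp rfl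
      rw [hψ]
      exact ⟨⟨p, h1, q, h3, rfl⟩, by rw [hH, h2, h4, add_zero]⟩

theorem symElem_eq_sum {m : ℕ} (p : Fin m → E) (j : ℕ) :
    symElem p j = ∑ t ∈ Finset.powersetCard j Finset.univ,
      ∏ i ∈ t, SymmetricAlgebra.ι ℝ E (p i) := by
  simp [symElem, MvPolynomial.esymm, map_sum, map_prod]

theorem symElem_comp_perm {m : ℕ} (p : Fin m → E) (e : Equiv.Perm (Fin m)) (j : ℕ) :
    symElem (p ∘ e) j = symElem p j := by
  have h := congrArg (MvPolynomial.aeval fun i => SymmetricAlgebra.ι ℝ E (p i))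
    (MvPolynomial.rename_esymm (Fin m) ℝ j e)
  rwa [MvPolynomial.aeval_rename] at h

theorem symElem_one {m : ℕ} (p : Fin m → E) :
    symElem p 1 = ∑ i, SymmetricAlgebra.ι ℝ E (p i) := by
  simp [symElem]

theorem lift_symElem_one {m : ℕ} (p : Fin m → E) (l : E →ₗ[ℝ] ℝ) :
    SymmetricAlgebra.lift l (symElem p 1) = ∑ i, l (p i) := by
  simp [symElem_one]

/-- Newton's identity in degree two; it makes products of values at distinct points accessible to a
linear functional of e₂. -/
theorem two_mul_lift_symElem_two {m : ℕ} (p : Fin m → E) (l : E →ₗ[ℝ] ℝ) :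
    2 * SymmetricAlgebra.lift l (symElem p 2) = (∑ i, l (p i)) ^ 2 - ∑ i, l (p i) ^ 2 := by
  have h := congrArg (MvPolynomial.aeval fun i => l (p i))
    (MvPolynomial.mul_esymm_eq_sum (Fin m) ℝ 2)
  have h1 : SymmetricAlgebra.lift l (symElem p 2) =
      MvPolynomial.eval (fun i => l (p i)) (MvPolynomial.esymm (Fin m) ℝ 2) := by
    simp [symElem, MvPolynomial.esymm, map_sum, map_prod]
  have h2 : (Finset.HasAntidiagonal.antidiagonal 2).filter (fun a : ℕ × ℕ => a.1 < 2) =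
      {(0, 2), (1, 1)} := by
    decide
  rw [h2] at h
  simp [MvPolynomial.psum] at h
  rw [h1, h]
  ring

theorem sq_sum_sub_sum_sq {m : ℕ} (a : Fin m → ℝ) :
    (∑ i, a i) ^ 2 - ∑ i, a i ^ 2 = ∑ i, ∑ j ∈ Finset.univ.erase i, a i * a j := by
  rw [sq, Finset.sum_mul_sum, ← Finset.sum_sub_distrib]
  refine Finset.sum_congr rfl fun i _ => ?_
  rw [← Finset.add_sum_erase _ _ (Finset.mem_univ i)]
  ring

/-- Elementary symmetric polynomials are affine in each variable: monomials containing `i₀`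
contribute `p` times a power of `q`, the others a constant. -/
theorem exists_affine_symElem {m : ℕ} (i₀ : Fin m) (q : E) :
    ∃ ψ : E →ᵃ[ℝ] (Fin m → SymmetricAlgebra ℝ E), ∀ p,
      ψ p = fun j => symElem (Function.update (fun _ => q) i₀ p) (j.val + 1) := by
  classical
  let Q := SymmetricAlgebra.ι ℝ E q
  let ψ : Fin m → E →ᵃ[ℝ] SymmetricAlgebra ℝ E := fun j =>
    (∑ t ∈ Finset.powersetCard (j.val + 1) Finset.univ, if i₀ ∈ t then
      (LinearMap.mulRight ℝ (Q ^ j.val)).comp (SymmetricAlgebra.ι ℝ E) else 0).toAffineMap +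
    AffineMap.const ℝ E (∑ t ∈ Finset.powersetCard (j.val + 1) Finset.univ,
      if i₀ ∈ t then 0 else Q ^ (j.val + 1))
  refine ⟨AffineMap.pi ψ, fun p => funext fun j => ?_⟩
  rw [symElem_eq_sum]
  change ψ j p = _
  simp only [ψ, AffineMap.coe_add, Pi.add_apply, LinearMap.coe_toAffineMap, LinearMap.sum_apply,
    AffineMap.const_apply, ← Finset.sum_add_distrib]
  refine Finset.sum_congr rfl fun t ht => ?_
  have hcard := (Finset.mem_powersetCard.mp ht).2
  split_ifs with hi
  · rw [← Finset.mul_prod_erase t _ hi, Finset.prod_congr rfl (g := fun _ => Q)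
      (fun i hi => by rw [Function.update_of_ne (Finset.ne_of_mem_erase hi)]),
      Finset.prod_const, Finset.card_erase_of_mem hi, hcard]
    simp
  · rw [Finset.prod_congr rfl (g := fun _ => Q) (fun i hi' => by
      rw [Function.update_of_ne (ne_of_mem_of_not_mem hi' hi)]), Finset.prod_const, hcard]
    simp

/-- Linear functionals extend to the symmetric algebra, and they separate the points of `E`. -/
theorem symmetricAlgebra_ι_injective : Function.Injective (SymmetricAlgebra.ι ℝ E) := by
  intro p p' h
  rw [← sub_eq_zero, ← Module.forall_dual_apply_eq_zero_iff ℝ]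
  intro l
  have := congrArg (SymmetricAlgebra.lift l) h
  simpa [sub_eq_zero] using this

theorem exists_face_convexSym {V : Type*} [AddCommGroup V] [Module ℝ V] {P : Set V}
    {K F : Set E} (hP : AffinelyIsomorphic P F) (hF : Convex ℝ F) {h : E →ᵃ[ℝ] ℝ}
    (hh : ∀ p ∈ K, 0 ≤ h p) (hFK : ∀ p, p ∈ F ↔ p ∈ K ∧ h p = 0) {g : E →ᵃ[ℝ] ℝ}
    (hg : ∀ p ∈ K, 0 ≤ g p) {q : E} (hq : ∀ p, p = q ↔ p ∈ K ∧ g p = 0) (hqF : q ∈ F)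
    {m : ℕ} (hm : 1 < m) :
    ∃ F', IsFaceOf (convexSym m K) F' ∧ AffinelyIsomorphic P F' := by
  classical
  let i₀ : Fin m := ⟨0, by omega⟩
  let i₁ : Fin m := ⟨1, hm⟩
  obtain ⟨ψ, hψ⟩ := exists_affine_symElem i₀ q
  have hdec : ∀ (f : E →ᵃ[ℝ] ℝ) p, f p = f.linear p + f 0 := fun f p => by
    rw [f.decomp']
    simp
  let Λ : Fin m → (E →ₗ[ℝ] ℝ) → (Fin m → SymmetricAlgebra ℝ E) →ₗ[ℝ] ℝ := fun j l =>
    (SymmetricAlgebra.lift l).toLinearMap.comp (LinearMap.proj j)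
  -- The coefficients come from expanding h = h.linear + h 0 and g = g.linear + g 0 in ∑ h(p_i) +
  -- ∑_{i≠j} g(p_i) g(p_j).
  let H : (Fin m → SymmetricAlgebra ℝ E) →ᵃ[ℝ] ℝ :=
    (Λ i₀ h.linear + (2 : ℝ) • Λ i₁ g.linear +
      (2 * (m - 1) * g 0) • Λ i₀ g.linear).toAffineMap +
    AffineMap.const ℝ _ (m * h 0 + m * (m - 1) * g 0 ^ 2)
  have hH : ∀ p : Fin m → E, H (fun j => symElem p (j.val + 1)) =
      ∑ i, h (p i) + ∑ i, ∑ j ∈ Finset.univ.erase i, g (p i) * g (p j) := by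
    intro p
    rw [← sq_sum_sub_sum_sq]
    have h2 := two_mul_lift_symElem_two p g.linear
    have h3 : H (fun j => symElem p (j.val + 1)) = ∑ i, h.linear (p i) +
        2 * SymmetricAlgebra.lift g.linear (symElem p 2) +
        2 * (m - 1) * g 0 * ∑ i, g.linear (p i) + (m * h 0 + m * (m - 1) * g 0 ^ 2) := by
      simp [H, Λ, i₀, i₁, lift_symElem_one]
    rw [h3, h2]
    simp only [hdec h (p _), hdec g (p _), add_sq, Finset.sum_add_distrib, Finset.sum_const,
      Finset.card_univ, Fintype.card_fin, nsmul_eq_mul, ← Finset.mul_sum, ← Finset.sum_mul]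
    ring
  refine exists_face_of_image_eq hP hF (H := H) (ψ := ψ) ?_ ?_ ?_
  · rintro _ ⟨p, hp, rfl⟩
    rw [hH]
    exact add_nonneg (Finset.sum_nonneg fun i _ => hh _ (hp i))
      (Finset.sum_nonneg fun i _ => Finset.sum_nonneg fun j _ =>
        mul_nonneg (hg _ (hp i)) (hg _ (hp j)))
  · intro p p' hpp
    rw [hψ, hψ] at hpp
    have h1 := congrFun hpp i₀
    simp only [i₀, zero_add, symElem_one] at h1
    rw [← Finset.add_sum_erase _ _ (Finset.mem_univ i₀),
      ← Finset.add_sum_erase _ _ (Finset.mem_univ i₀)] at h1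
    rw [Finset.sum_congr rfl (s₁ := Finset.univ.erase i₀)
      (g := fun _ => SymmetricAlgebra.ι ℝ E q) (fun i hi => by
        rw [Function.update_of_ne (Finset.ne_of_mem_erase hi)]),
      Finset.sum_congr rfl (s₁ := Finset.univ.erase i₀)
      (g := fun _ => SymmetricAlgebra.ι ℝ E q) (f := fun i => SymmetricAlgebra.ι ℝ E
        (Function.update (fun _ => q) _ p' i)) (fun i hi => by
        rw [Function.update_of_ne (Finset.ne_of_mem_erase hi)])] at h1
    have h2 := add_right_cancel h1
    simp only [i₀, Function.update_self] at h2
    exact symmetricAlgebra_ι_injective h2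
  · ext a
    constructor
    · rintro ⟨⟨p, hp, rfl⟩, h0⟩
      rw [hH] at h0
      have hs1 : 0 ≤ ∑ i, h (p i) := Finset.sum_nonneg fun i _ => hh _ (hp i)
      have hs2 : 0 ≤ ∑ i, ∑ j ∈ Finset.univ.erase i, g (p i) * g (p j) :=
        Finset.sum_nonneg fun i _ => Finset.sum_nonneg fun j _ =>
          mul_nonneg (hg _ (hp i)) (hg _ (hp j))
      have hz1 : ∀ i, h (p i) = 0 := fun i =>
        (Finset.sum_eq_zero_iff_of_nonneg fun i _ => hh _ (hp i)).mp (by linarith) i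
          (Finset.mem_univ i)
      have hz2 : ∀ i j, j ≠ i → g (p i) * g (p j) = 0 := fun i j hij => by
        have h1 := (Finset.sum_eq_zero_iff_of_nonneg fun i _ =>
          Finset.sum_nonneg fun j _ => mul_nonneg (hg _ (hp i)) (hg _ (hp j))).mp
          (show ∑ i, ∑ j ∈ Finset.univ.erase i, g (p i) * g (p j) = 0 by linarith) i
          (Finset.mem_univ i)
        exact (Finset.sum_eq_zero_iff_of_nonneg fun j _ =>
          mul_nonneg (hg _ (hp i)) (hg _ (hp j))).mp h1 j (by simp [hij])
      -- Pairwise products of the `g (p i)` vanish, so at most one is nonzero. By symmetry of the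
      -- e_j the exceptional index is then swapped with `i₀`.
      have hex : ∃ i, ∀ j, j ≠ i → p j = q := by
        by_cases hall : ∃ i, g (p i) ≠ 0
        · obtain ⟨i, hi⟩ := hall
          exact ⟨i, fun j hj => (hq _).mpr
            ⟨hp j, (mul_eq_zero.mp (hz2 i j hj)).resolve_left hi⟩⟩
        · exact ⟨i₀, fun j _ => (hq _).mpr ⟨hp j, by
            by_contra h
            exact hall ⟨j, h⟩⟩⟩
      obtain ⟨i, hi⟩ := hex
      refine ⟨p i, (hFK _).mpr ⟨hp i, hz1 i⟩, ?_⟩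
      rw [hψ]
      have hperm : Function.update (fun _ => q) i₀ (p i) = p ∘ Equiv.swap i₀ i := by
        ext1 j
        by_cases hj : j = i₀
        · subst hj
          simp
        · rw [Function.update_of_ne hj, Function.comp_apply, hi]
          intro hji
          apply hj
          rw [← Equiv.swap_apply_left i₀ i] at hji
          exact (Equiv.swap i₀ i).injective hji
      rw [hperm]
      exact funext fun j => symElem_comp_perm p _ _
    · rintro ⟨p, hp, rfl⟩
      obtain ⟨h1, h2⟩ := (hFK p).mp hp
      obtain ⟨h3, h4⟩ := (hFK q).mp hqF
      have h5 := ((hq q).mp rfl).2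
      rw [hψ]
      refine ⟨⟨_, fun i => ?_, rfl⟩, ?_⟩
      · by_cases hi : i = i₀
        · subst hi
          simpa using h1
        · simpa [hi] using h3
      · rw [hH]
        have hsum1 : ∀ i, h (Function.update (fun _ => q) i₀ p i) = 0 := fun i => by
          by_cases hi : i = i₀
          · subst hi
            simpa using h2
          · simpa [hi] using h4
        rw [Finset.sum_eq_zero fun i _ => hsum1 i, zero_add]
        refine Finset.sum_eq_zero fun i _ => Finset.sum_eq_zero fun j hj => ?_
        by_cases hi : i = i₀
        · have hj' : j ≠ i₀ := hi ▸ Finset.ne_of_mem_erase hj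
          simp [hj', h5]
        · simp [hi, h5]

end Faces

/-! ### Faces of the traveling salesman polytope -/

theorem tourMatrices_apply_eq {n : ℕ} {A : Matrix (Fin n) (Fin n) ℝ} (hA : A ∈ tourMatrices n)
    (v w : Fin n) : A v w = 0 ∨ A v w = 1 := by
  obtain ⟨f, -, rfl⟩ := exists_eq_tourMatrix hA
  unfold tourMatrix
  split_ifs <;> simp

theorem sub_tourCenter_mem {n : ℕ} {A : Matrix (Fin n) (Fin n) ℝ}
    (hA : A ∈ convexHull ℝ (tourMatrices n)) :
    A - tourCenter n ∈ vectorSpan ℝ (tourMatrices n) := by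
  have hne : (tourMatrices n).Nonempty := convexHull_nonempty_iff.mp ⟨A, hA⟩
  have hc : tourCenter n ∈ convexHull ℝ (tourMatrices n) := by
    have := Finset.centroid_mem_convexHull (R := ℝ) (finite_tourMatrices n).toFinset
      (by simpa using hne)
    rwa [Set.Finite.coe_toFinset] at this
  rw [← direction_affineSpan]
  exact AffineSubspace.vsub_mem_direction (convexHull_subset_affineSpan _ hA)
    (convexHull_subset_affineSpan _ hc)

/-- The inclusion of the space of `STSP n` into the space of matrices. -/
noncomputable def tourInclusion (n : ℕ) :
    vectorSpan ℝ (tourMatrices n) →ᵃ[ℝ] Matrix (Fin n) (Fin n) ℝ :=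
  (vectorSpan ℝ (tourMatrices n)).subtype.toAffineMap + AffineMap.const ℝ _ (tourCenter n)

theorem tourInclusion_apply {n : ℕ} (x : vectorSpan ℝ (tourMatrices n)) :
    tourInclusion n x = x + tourCenter n := rfl

theorem tourInclusion_injective (n : ℕ) : Function.Injective (tourInclusion n) := by
  intro x y h
  rw [tourInclusion_apply, tourInclusion_apply] at h
  exact Subtype.ext (add_right_cancel h)

theorem mem_STSP {n : ℕ} {x : vectorSpan ℝ (tourMatrices n)} :
    x ∈ STSP n ↔ tourInclusion n x ∈ convexHull ℝ (tourMatrices n) := Iff.rfl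

theorem exists_tourInclusion_eq {n : ℕ} {A : Matrix (Fin n) (Fin n) ℝ}
    (hA : A ∈ convexHull ℝ (tourMatrices n)) : ∃ x, tourInclusion n x = A :=
  ⟨⟨_, sub_tourCenter_mem hA⟩, by rw [tourInclusion_apply]; exact sub_add_cancel _ _⟩

/-- Away from `P` the given map may leave the affine span of the tours, so it is followed by a
linear retraction onto the direction of that span. -/
theorem affinelyIsomorphic_preimage_tourInclusion {n d : ℕ} {P : Set (Fin d → ℝ)}
    {F : Set (Matrix (Fin n) (Fin n) ℝ)} (hF : F ⊆ convexHull ℝ (tourMatrices n))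
    (h : AffinelyIsomorphic P F) : AffinelyIsomorphic P (tourInclusion n ⁻¹' F) := by
  obtain ⟨f, hf⟩ := h
  obtain ⟨π, hπ⟩ := LinearMap.exists_leftInverse_of_injective
    (vectorSpan ℝ (tourMatrices n)).subtype (Submodule.ker_subtype _)
  have hπ' : ∀ x, π (tourInclusion n x - tourCenter n) = x := fun x => by
    rw [tourInclusion_apply, add_sub_cancel_right]
    exact LinearMap.congr_fun hπ x
  let f' : (Fin d → ℝ) →ᵃ[ℝ] vectorSpan ℝ (tourMatrices n) :=
    π.toAffineMap.comp (f - AffineMap.const ℝ _ (tourCenter n))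
  have hf' : ∀ s ∈ P, tourInclusion n (f' s) = f s := by
    intro s hs
    obtain ⟨x, hx⟩ := exists_tourInclusion_eq (hF (hf.mapsTo hs))
    have : f' s = x := by
      rw [← hπ' x, hx]
      rfl
    rw [this, hx]
  refine ⟨f', fun s hs => ?_, fun s hs t ht hst => ?_, fun x hx => ?_⟩
  · rw [Set.mem_preimage, hf' s hs]
    exact hf.mapsTo hs
  · exact hf.injOn hs ht (by rw [← hf' s hs, hst, hf' t ht])
  · obtain ⟨s, hs, hsx⟩ := hf.surjOn hx
    exact ⟨s, hs, tourInclusion_injective n (by rw [hf' s hs, hsx])⟩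

/-- The tour matrices supported in a given graph are the zeros of a valid inequality. -/
theorem exists_affine_support {n : ℕ} (G : Fin n → Fin n → Prop) :
    ∃ h : Matrix (Fin n) (Fin n) ℝ →ᵃ[ℝ] ℝ, ∀ A ∈ tourMatrices n, 0 ≤ h A ∧
      (h A = 0 ↔ ∀ v w, ¬ G v w → A v w = 0) := by
  classical
  let h : Matrix (Fin n) (Fin n) ℝ →ₗ[ℝ] ℝ :=
    ∑ v, ∑ w, if G v w then 0 else Matrix.entryLinearMap ℝ ℝ v w
  have hh : ∀ A, h A = ∑ v, ∑ w, if G v w then 0 else A v w := by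
    intro A
    simp only [h, LinearMap.sum_apply]
    refine Finset.sum_congr rfl fun v _ => Finset.sum_congr rfl fun w _ => ?_
    split_ifs <;> rfl
  refine ⟨h.toAffineMap, fun A hA => ?_⟩
  have hpos : ∀ v w, 0 ≤ if G v w then 0 else A v w := by
    intro v w
    split_ifs
    · exact le_rfl
    · rcases tourMatrices_apply_eq hA v w with h | h <;> rw [h]
      exact zero_le_one
  rw [LinearMap.coe_toAffineMap, hh]
  refine ⟨Finset.sum_nonneg fun v _ => Finset.sum_nonneg fun w _ => hpos v w, ?_⟩
  rw [Finset.sum_eq_zero_iff_of_nonneg fun v _ => Finset.sum_nonneg fun w _ => hpos v w]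
  simp only [Finset.mem_univ, true_imp_iff,
    Finset.sum_eq_zero_iff_of_nonneg fun w _ => hpos _ w, ite_eq_left_iff]

/-- Every tour matrix is the only zero of a valid inequality among the tour matrices. -/
theorem exists_affine_eq_zero_iff {n : ℕ} {B : Matrix (Fin n) (Fin n) ℝ}
    (hB : B ∈ tourMatrices n) :
    ∃ g : Matrix (Fin n) (Fin n) ℝ →ᵃ[ℝ] ℝ, ∀ A ∈ tourMatrices n, 0 ≤ g A ∧
      (g A = 0 ↔ A = B) := by
  -- On 0/1 matrices this is the Hamming distance to `B`.
  let g : Matrix (Fin n) (Fin n) ℝ →ᵃ[ℝ] ℝ :=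
    (∑ v, ∑ w, (1 - 2 * B v w) • Matrix.entryLinearMap ℝ ℝ v w).toAffineMap +
    AffineMap.const ℝ _ (∑ v, ∑ w, B v w)
  have hg : ∀ A, g A = ∑ v, ∑ w, (B v w + (1 - 2 * B v w) * A v w) := by
    intro A
    have : g A = (∑ v, ∑ w, (1 - 2 * B v w) * A v w) + ∑ v, ∑ w, B v w := by
      simp [g]
    rw [this]
    simp only [Finset.sum_add_distrib]
    ring
  refine ⟨g, fun A hA => ?_⟩
  have key : ∀ v w, 0 ≤ B v w + (1 - 2 * B v w) * A v w ∧
      (B v w + (1 - 2 * B v w) * A v w = 0 ↔ A v w = B v w) := by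
    intro v w
    rcases tourMatrices_apply_eq hA v w with h | h <;>
      rcases tourMatrices_apply_eq hB v w with h' | h' <;> rw [h, h'] <;> norm_num
  rw [hg]
  refine ⟨Finset.sum_nonneg fun v _ => Finset.sum_nonneg fun w _ => (key v w).1, ?_⟩
  rw [Finset.sum_eq_zero_iff_of_nonneg fun v _ => Finset.sum_nonneg fun w _ => (key v w).1]
  simp only [Finset.mem_univ, true_imp_iff,
    Finset.sum_eq_zero_iff_of_nonneg fun w _ => (key _ w).1, (key _ _).2]
  exact ⟨fun h => Matrix.ext h, fun h v w => by rw [h]⟩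

/-! ### Polytopes with vertices in the cube -/

theorem IsZeroOnePolytope.exists_eq_convexHull {d : ℕ} {P : Set (Fin d → ℝ)}
    (hP : IsZeroOnePolytope P) :
    ∃ S : Set (Fin d → Bool), P = convexHull ℝ (cubeVertex '' S) := by
  classical
  obtain ⟨⟨X, rfl⟩, hvert⟩ := hP
  have hfin : ((convexHull ℝ (X : Set (Fin d → ℝ))).extremePoints ℝ).Finite :=
    X.finite_toSet.subset extremePoints_convexHull_subset
  refine ⟨{s | cubeVertex s ∈ (convexHull ℝ (X : Set (Fin d → ℝ))).extremePoints ℝ}, ?_⟩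
  have himage : cubeVertex '' {s | cubeVertex s ∈
      (convexHull ℝ (X : Set (Fin d → ℝ))).extremePoints ℝ} =
      (convexHull ℝ (X : Set (Fin d → ℝ))).extremePoints ℝ := by
    refine Set.Subset.antisymm ?_ fun x hx => ?_
    · rintro _ ⟨s, hs, rfl⟩
      exact hs
    · have : cubeVertex (fun i => decide (x i = 1)) = x := by
        ext i
        rcases hvert x hx i with h | h <;> simp [cubeVertex, h]
      exact ⟨_, by rw [Set.mem_ofPred_eq, this]; exact hx, this⟩
  rw [himage]
  -- Krein–Milman; the closure is superfluous because there are finitely many extreme points.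
  conv_lhs => rw [← closure_convexHull_extremePoints (X.finite_toSet.isCompact_convexHull ℝ)
    (convex_convexHull ℝ _)]
  exact (hfin.isClosed_convexHull ℝ).closure_eq

/-- For large `n`, every nonempty set of vertices of the cube is affinely equivalent to the set of
all tour matrices satisfying a valid inequality with equality. -/
theorem exists_affinelyIsomorphic_tourMatrices {d : ℕ} {S : Set (Fin d → Bool)}
    (hS : S.Nonempty) : ∃ N, 3 ≤ N ∧ ∀ n, N ≤ n → ∃ G : Fin n → Fin n → Prop,
      {A ∈ tourMatrices n | ∀ v w, ¬ G v w → A v w = 0}.Nonempty ∧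
      AffinelyIsomorphic (convexHull ℝ (cubeVertex '' S))
        (convexHull ℝ {A ∈ tourMatrices n | ∀ v w, ¬ G v w → A v w = 0}) := by
  -- A constant extra coordinate keeps the index type nonempty, as the construction requires, even
  -- for `d = 0`.
  let ext : (Fin d → Bool) → Option (Fin d) → Bool := fun s o => o.elim true s
  obtain ⟨N, hN, h⟩ := exists_affine_image_eq (S := ext '' S) (hS.image _)
  refine ⟨N, hN, fun n hn => ?_⟩
  obtain ⟨G, T, hT, hcoord⟩ := h n hn
  refine ⟨G, ?_, ?_⟩
  · rw [← hT]
    exact ((hS.image _).image _).image _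
  let κ : (Fin d → ℝ) →ᵃ[ℝ] (Option (Fin d) → ℝ) :=
    AffineMap.pi fun o => o.elim (AffineMap.const ℝ _ 1) fun i => (LinearMap.proj i).toAffineMap
  have hκ : ∀ s : Fin d → Bool, κ (cubeVertex s) = cubeVertex (ext s) := by
    intro s
    ext o
    rcases o with _ | i
    · simp [κ, ext, cubeVertex]
    · rfl
  have himage : (T.comp κ) '' (convexHull ℝ (cubeVertex '' S)) =
      convexHull ℝ {A ∈ tourMatrices n | ∀ v w, ¬ G v w → A v w = 0} := by
    rw [AffineMap.image_convexHull, ← hT]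
    congr 1
    simp only [Set.image_image, AffineMap.coe_comp, Function.comp_apply, hκ]
  refine ⟨T.comp κ, ?_⟩
  rw [← himage]
  refine Set.InjOn.bijOn_image ?_
  choose v w hvw using fun i => hcoord (some i)
  -- The entry recording bit `i` equals coordinate `i` at the generators, hence by affinity on the
  -- whole hull; this gives injectivity.
  have hinv : ∀ x ∈ convexHull ℝ (cubeVertex '' S), ∀ i, (T.comp κ) x (v i) (w i) = x i := by
    intro x hx i
    let entry : Matrix (Fin n) (Fin n) ℝ →ₗ[ℝ] ℝ :=
      Matrix.entryLinearMap ℝ ℝ (v i) (w i)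
    let δ : (Fin d → ℝ) →ᵃ[ℝ] ℝ :=
      entry.toAffineMap.comp (T.comp κ) - (LinearMap.proj i).toAffineMap
    have hδ : δ x = 0 := by
      suffices hsub : cubeVertex '' S ⊆ {y ∈ cubeVertex '' S | δ y = 0} from
        eq_zero_of_mem_convexHull (convexHull_mono hsub hx)
      rintro _ ⟨s, hs, rfl⟩
      refine ⟨⟨s, hs, rfl⟩, ?_⟩
      have := hvw i (ext s) ⟨s, hs, rfl⟩
      rw [← hκ] at this
      change T (κ (cubeVertex s)) (v i) (w i) - cubeVertex s i = 0
      rw [this]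
      exact sub_self (cubeVertex s i)
    exact sub_eq_zero.mp hδ
  intro x hx y hy hxy
  ext i
  rw [← hinv x hx i, ← hinv y hy i, hxy]

theorem exists_faces {n : ℕ} {d : ℕ} {P : Set (Fin d → ℝ)} {G : Fin n → Fin n → Prop}
    (hne : {A ∈ tourMatrices n | ∀ v w, ¬ G v w → A v w = 0}.Nonempty)
    (hP : AffinelyIsomorphic P
      (convexHull ℝ {A ∈ tourMatrices n | ∀ v w, ¬ G v w → A v w = 0})) :
    (∃ F, IsFaceOf (twoTierTSP n) F ∧ AffinelyIsomorphic P F) ∧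
      ∀ m : ℕ, 1 < m → ∃ F, IsFaceOf (romanTSP m n) F ∧ AffinelyIsomorphic P F := by
  obtain ⟨B, hB, hBG⟩ := hne
  obtain ⟨h, hh⟩ := exists_affine_support G
  obtain ⟨g, hg⟩ := exists_affine_eq_zero_iff hB
  have hset : {A ∈ tourMatrices n | ∀ v w, ¬ G v w → A v w = 0} =
      {A ∈ tourMatrices n | h A = 0} := by
    ext A
    exact and_congr_right fun hA => (hh A hA).2.symm
  have hset' : {A ∈ tourMatrices n | g A = 0} = {B} := by
    ext A
    exact ⟨fun hA => ((hg A hA.1).2).mp hA.2, fun hA => by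
      obtain rfl : A = B := hA
      exact ⟨hB, ((hg A hB).2).mpr rfl⟩⟩
  rw [hset] at hP
  have hBconv := subset_convexHull ℝ _ hB
  obtain ⟨q, hqB⟩ := exists_tourInclusion_eq hBconv
  have hsub : convexHull ℝ {A ∈ tourMatrices n | h A = 0} ⊆ convexHull ℝ (tourMatrices n) :=
    convexHull_mono fun A hA => hA.1
  have hP' := affinelyIsomorphic_preimage_tourInclusion hsub hP
  have hF := (convex_convexHull ℝ {A ∈ tourMatrices n | h A = 0}).affine_preimage
    (tourInclusion n)
  have hhK : ∀ p ∈ STSP n, 0 ≤ (h.comp (tourInclusion n)) p := fun p hp =>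
    (nonneg_and_mem_of_mem_convexHull (fun A hA => (hh A hA).1) (mem_STSP.mp hp)).1
  have hgK : ∀ p ∈ STSP n, 0 ≤ (g.comp (tourInclusion n)) p := fun p hp =>
    (nonneg_and_mem_of_mem_convexHull (fun A hA => (hg A hA).1) (mem_STSP.mp hp)).1
  have hFK : ∀ p, p ∈ tourInclusion n ⁻¹' (convexHull ℝ {A ∈ tourMatrices n | h A = 0}) ↔
      p ∈ STSP n ∧ (h.comp (tourInclusion n)) p = 0 := fun p =>
    ⟨fun hp => ⟨hsub hp, eq_zero_of_mem_convexHull (h := h) hp⟩, fun hp =>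
      (nonneg_and_mem_of_mem_convexHull (fun A hA => (hh A hA).1) (mem_STSP.mp hp.1)).2 hp.2⟩
  have hq : ∀ p, p = q ↔ p ∈ STSP n ∧ (g.comp (tourInclusion n)) p = 0 := by
    intro p
    constructor
    · rintro rfl
      refine ⟨mem_STSP.mpr (hqB.symm ▸ hBconv), ?_⟩
      rw [AffineMap.comp_apply, hqB]
      exact ((hg B hB).2).mpr rfl
    · rintro ⟨hp, hp0⟩
      have := (nonneg_and_mem_of_mem_convexHull (fun A hA => (hg A hA).1)
        (mem_STSP.mp hp)).2 hp0
      rw [hset', convexHull_singleton, Set.mem_singleton_iff] at this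
      exact tourInclusion_injective n (this.trans hqB.symm)
  refine ⟨exists_face_convexTensor hP' hF hhK hFK hgK hq, fun m hm =>
    exists_face_convexSym hP' hF hhK hFK hgK hq ((hFK q).mpr ⟨((hq q).mp rfl).1, ?_⟩) hm⟩
  rw [AffineMap.comp_apply, hqB]
  exact ((hh B hB).2).mpr hBG

theorem isFaceOf_empty {V : Type*} [AddCommGroup V] [Module ℝ V] (C : Set V) :
    IsFaceOf C ∅ :=
  ⟨convex_empty, Set.empty_subset _, fun _ _ _ _ _ hz => hz.elim⟩

theorem affinelyIsomorphic_empty {V W : Type*} [AddCommGroup V] [Module ℝ V] [AddCommGroup W]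
    [Module ℝ W] : AffinelyIsomorphic (∅ : Set V) (∅ : Set W) :=
  ⟨AffineMap.const ℝ V 0, Set.bijOn_empty _⟩

theorem mainTheorem9 (d : ℕ) :
    ∃ N : ℕ, 0 < N ∧ ∀ n : ℕ, N ≤ n → ∀ P : Set (Fin d → ℝ), IsZeroOnePolytope P →
      (∃ F, IsFaceOf (twoTierTSP n) F ∧ AffinelyIsomorphic P F) ∧
      ∀ m : ℕ, 1 < m → ∃ F, IsFaceOf (romanTSP m n) F ∧ AffinelyIsomorphic P F := by
  classical
  choose! N hN hfaces using fun (S : Set (Fin d → Bool)) (hS : S.Nonempty) =>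
    exists_affinelyIsomorphic_tourMatrices hS
  -- The supremum runs over the finitely many sets of cube vertices; the value of `N` at the empty
  -- set is arbitrary, and the empty polytope is matched with the empty face.
  refine ⟨Finset.univ.sup N + 1, Nat.succ_pos _, fun n hn P hP => ?_⟩
  obtain ⟨S, rfl⟩ := hP.exists_eq_convexHull
  rcases S.eq_empty_or_nonempty with rfl | hS
  · rw [Set.image_empty, convexHull_empty]
    exact ⟨⟨∅, isFaceOf_empty _, affinelyIsomorphic_empty⟩,
      fun m _ => ⟨∅, isFaceOf_empty _, affinelyIsomorphic_empty⟩⟩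
  · have hle : N S ≤ Finset.univ.sup N := Finset.le_sup (Finset.mem_univ S)
    obtain ⟨G, hne, hiso⟩ := hfaces S hS n (by omega)
    exact exists_faces hne hiso
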